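/- Let $d\in\mathbb N$, let $\mathcal H$ be a complex Hilbert space, let $0<p<\infty$, and let $\nu:\mathbb Z^d\to[0,\infty)$ be an admissible weight, that is, $\nu(x+y)\le\nu(x)\nu(y)$, $\nu(-x)=\nu(x)$ and $\lim_{n\to\infty}\nu(nx)^{1/n}=1$ for all $x,y\in\mathbb Z^d$. If $p>1$, let $p'=p/(p-1)$ and assume also that $\nu$ is a $p$-algebra weight, that is, $\sum_{m\in\mathbb Z^d}\nu(m)^{-p'}\nu(n-m)^{-p'}\le\nu(n)^{-p'}$ for all $n\in\mathbb Z^d$, and that $\sum_{n\in\mathbb Z^d}\nu(n)^{-p'}<\infty$. Let $\mathcal C^p_\nu$ be the set of all $B(\mathcal H)$-valued matrices $A=[A_{k,l}]_{k,l\in\mathbb Z^d}$ with $$|A|=\sum_{l\in\mathbb Z^d}\Big(\sup_{k\in\mathbb Z^d}\|A_{k,k-l}\|\Big)^p\nu(l)^p<\infty .$$ Then every $A\in\mathcal C^p_\nu$ acts as a bounded operator on $\ell^2(\mathbb Z^d,\mathcal H)$ by $(Ax)_k=\sum_{l}A_{k,l}x_l$ and, with each such matrix identified with the operator it defines, $\mathcal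 C^p_\nu$ is a unital $*$-subalgebra of $B(\ell^2(\mathbb Z^d,\mathcal H))$ which is inverse closed: if $A\in\mathcal C^p_\nu$ is invertible in $B(\ell^2(\mathbb Z^d,\mathcal H))$, then $A^{-1}\in\mathcal C^p_\nu$. In particular, $\mathcal C^p_\nu$ is a symmetric $p$-Banach $*$-algebra with the $p$-norm $|\cdot|$ if $p\le1$, and a symmetric Banach $*$-algebra with the norm $|\cdot|^{1/p}$ if $p>1$. Here, for $0<r\le1$, an $r$-Banach $*$-algebra is a complex $*$-algebra with a map $N$ to $[0,\infty)$ such that $N(x)=0$ if and only if $x=0$, $N(x+y)\le N(x)+N(y)$, $N(\alpha x)=|\alpha|^rN(x)$ for $\alpha\in\mathbb C$, $N(xy)\le N(x)N(y)$, $N(x^*)=N(x)$, and every $N$-Cauchy sequence converges; a Banach $*$-algebra is the case $r=1$; and the algebra is symmetric if the spectrum of $aa^*$ in it is contained in $[0,\infty)$ for each of its elements $a$. -/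

import Mathlib

open scoped NNReal ENNReal
open Filter Topology

noncomputable section

namespace BGS

/-! ### Weights on the lattice -/

/-- Admissible weights on `ℤ^d`: submultiplicative, symmetric, and satisfying the
GRS condition `lim ν(n x)^{1/n} = 1` for every `x`. -/
structure IsAdmissible {d : ℕ} (ν : (Fin d → ℤ) → ℝ≥0) : Prop where
  submul : ∀ x y, ν (x + y) ≤ ν x * ν y
  symm : ∀ x, ν (-x) = ν x
  grs : ∀ x, Tendsto (fun n : ℕ => ν (n • x) ^ (1 / (n : ℝ))) atTop (𝓝 1)

/-- The `p`-algebra condition `ν^{-p'} ⋆ ν^{-p'} ≤ ν^{-p'}` (convolution on `ℤ^d`),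
where `1/p + 1/p' = 1`. -/
def IsPAlgebraWeight {d : ℕ} (p : ℝ) (ν : (Fin d → ℤ) → ℝ≥0) : Prop :=
  ∀ n, ∑' m, (ν m : ℝ≥0∞) ^ (-p.conjExponent) * (ν (n - m) : ℝ≥0∞) ^ (-p.conjExponent)
    ≤ (ν n : ℝ≥0∞) ^ (-p.conjExponent)

/-! ### Operator-valued matrices and operators on `ℓ²(ℤ^d, H)` -/

/-- The space `ℓ²(ℤ^d, H)`. -/
abbrev L2 (d : ℕ) (H : Type*) [NormedAddCommGroup H] : Type _ :=
  lp (fun _ : Fin d → ℤ => H) 2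

/-- Matrices indexed by `ℤ^d` with entries in `B(H)`. -/
abbrev OpMatrix (d : ℕ) (H : Type*) [NormedAddCommGroup H] [InnerProductSpace ℂ H] : Type _ :=
  (Fin d → ℤ) → (Fin d → ℤ) → (H →L[ℂ] H)

section

variable {d : ℕ} {H : Type*} [NormedAddCommGroup H] [InnerProductSpace ℂ H]

/-- The `k`-th coordinate map `x ↦ x_k` on `ℓ²(ℤ^d, H)`. -/
def coord (k : Fin d → ℤ) : L2 d H →L[ℂ] H :=
  LinearMap.mkContinuous
    { toFun := fun x => x k
      map_add' := fun _ _ => rfl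
      map_smul' := fun _ _ => rfl } 1
    (fun x => (lp.norm_apply_le_norm two_ne_zero x k).trans_eq (one_mul _).symm)

@[simp] theorem coord_apply (k : Fin d → ℤ) (x : L2 d H) : coord k x = x k := rfl

/-- The canonical matrix `[T_{k,l}]` of a bounded operator `T` on `ℓ²(ℤ^d, H)`. -/
def canonicalMatrix (T : L2 d H →L[ℂ] L2 d H) : OpMatrix d H := fun k l =>
  (coord k).comp (T.comp (lp.singleContinuousLinearMap ℂ (fun _ : Fin d → ℤ => H) 2 l))

/-- `A` is the canonical matrix of `T` iff `(T x)_k = ∑_l A_{k,l} x_l` for all `x` and `k`. -/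
theorem canonicalMatrix_eq_iff (T : L2 d H →L[ℂ] L2 d H) (A : OpMatrix d H) :
    canonicalMatrix T = A ↔
      ∀ (x : L2 d H) (k : Fin d → ℤ), HasSum (fun l => A k l (x l)) (T x k) := by
  constructor
  · rintro rfl x k
    have h := lp.hasSum_single (E := fun _ : Fin d → ℤ => H) (p := 2) (by simp) x
    exact h.mapL ((coord k).comp T)
  · intro h
    funext k l
    ext v
    have h1 := h (lp.single 2 l v) k
    have h2 := hasSum_single (f := fun m => A k m ((lp.single 2 l v : L2 d H) m)) l
      (fun m hm => by rw [lp.single_apply_ne _ _ _ hm, map_zero])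
    have h3 := h1.unique h2
    simpa [canonicalMatrix] using h3

/-- The canonical matrix of a composition is the matrix product. -/
theorem hasSum_canonicalMatrix_mul (S T : L2 d H →L[ℂ] L2 d H) (k l : Fin d → ℤ) (v : H) :
    HasSum (fun m => canonicalMatrix S k m (canonicalMatrix T m l v))
      (canonicalMatrix (S * T) k l v) :=
  (canonicalMatrix_eq_iff S _).1 rfl (T (lp.single 2 l v)) k

/-- The canonical matrix of the Hilbert space adjoint is the transposed matrix of adjoints. -/
theorem canonicalMatrix_star [CompleteSpace H] (T : L2 d H →L[ℂ] L2 d H) (k l : Fin d → ℤ) :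
    canonicalMatrix (star T) k l = star (canonicalMatrix T l k) := by
  ext v
  refine ext_inner_right ℂ fun w => ?_
  have h1 := lp.inner_single_right (𝕜 := ℂ) (G := fun _ : Fin d → ℤ => H) k w
    (star T (lp.single 2 l v))
  have h2 := lp.inner_single_left (𝕜 := ℂ) (G := fun _ : Fin d → ℤ => H) l v
    (T (lp.single 2 k w))
  rw [ContinuousLinearMap.star_eq_adjoint, ContinuousLinearMap.adjoint_inner_left] at h1
  rw [ContinuousLinearMap.star_eq_adjoint, ContinuousLinearMap.star_eq_adjoint,
    ContinuousLinearMap.adjoint_inner_left]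
  exact h1.symm.trans h2

/-! ### The weighted Baskakov–Gohberg–Sjöstrand class -/

/-- `∑_l (sup_k ‖A_{k,k-l}‖)^p ν(l)^p`, as an extended nonnegative real number. -/
def bgsSum (p : ℝ) (ν : (Fin d → ℤ) → ℝ≥0) (A : OpMatrix d H) : ℝ≥0∞ :=
  ∑' l, (⨆ k, ‖A k (k - l)‖ₑ) ^ p * (ν l : ℝ≥0∞) ^ p

/-- The class `C^p_ν` of `B(H)`-valued matrices. -/
def bgsClass (d : ℕ) (H : Type*) [NormedAddCommGroup H] [InnerProductSpace ℂ H]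
    (p : ℝ) (ν : (Fin d → ℤ) → ℝ≥0) : Set (OpMatrix d H) :=
  {A | bgsSum p ν A < ∞}

/-- The `p`-norm (if `p ≤ 1`), respectively the norm (if `p > 1`), of `C^p_ν`. -/
def bgsNorm (p : ℝ) (ν : (Fin d → ℤ) → ℝ≥0) (A : OpMatrix d H) : ℝ :=
  if p ≤ 1 then (bgsSum p ν A).toReal else (bgsSum p ν A).toReal ^ (1 / p)

end

/-! ### Notions about algebras -/

/-- `N` makes the complex `*`-algebra `𝒜` an `r`-Banach `*`-algebra (a Banach `*`-algebra if
`r = 1`): `N` is a complete submultiplicative `r`-norm for which the involution is isometric. -/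
structure IsPBanachStarAlgebra (r : ℝ) {𝒜 : Type*} [Ring 𝒜] [StarRing 𝒜] [Algebra ℂ 𝒜]
    [StarModule ℂ 𝒜] (N : 𝒜 → ℝ) : Prop where
  nonneg : ∀ a, 0 ≤ N a
  eq_zero_iff : ∀ a, N a = 0 ↔ a = 0
  add_le : ∀ a b, N (a + b) ≤ N a + N b
  smul_eq : ∀ (c : ℂ) (a : 𝒜), N (c • a) = ‖c‖ ^ r * N a
  mul_le : ∀ a b, N (a * b) ≤ N a * N b
  star_eq : ∀ a, N (star a) = N a
  complete : ∀ u : ℕ → 𝒜,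
    (∀ ε > 0, ∃ n₀, ∀ m ≥ n₀, ∀ n ≥ n₀, N (u m - u n) < ε) →
      ∃ a, Tendsto (fun n => N (u n - a)) atTop (𝓝 0)

/-- A complex `*`-algebra is symmetric if `σ(a a^*) ⊆ [0, ∞)` for all `a`. -/
def IsSymmetricAlgebra (𝒜 : Type*) [Ring 𝒜] [StarRing 𝒜] [Algebra ℂ 𝒜] : Prop :=
  ∀ a : 𝒜, spectrum ℂ (a * star a) ⊆ Complex.ofReal '' Set.Ici 0

/-- A subalgebra (with the same unit) is inverse closed if each of its elements that is
invertible in the large algebra is invertible in the subalgebra. -/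
def IsInverseClosed {ℬ : Type*} [Ring ℬ] [Algebra ℂ ℬ] (S : Subalgebra ℂ ℬ) : Prop :=
  ∀ a : S, IsUnit (a : ℬ) → IsUnit a

end BGS

end

/-!
The diagonal suprema of a matrix form a nonnegative sequence on `ℤ^d`, the decay of the matrix, and
the decay of a product is at most the convolution of the decays. Everything is therefore reduced to
convolution inequalities, apart from the decay of an inverse `S = T⁻¹`.

* Without weight, cut out functions by tents of size `N`. The commutators of `T` with the tents act
  on local norms as convolution by a sequence whose mass tends to `0` as `N → ∞`, so for large `N`
  the local norms `u` of `S e` satisfy `u ≤ ‖S‖ f + α * u`, where `f` are the local norms of `e` and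
  `α` has mass less than `1`. The Neumann series of `α` then bounds the off-diagonal decay of `S`.
* With weight, choose a band-limited `B` so close to `S` that `R = 1 - T B` has decay of mass less
  than `1`. By the GRS condition the weighted norms of the powers of a sequence grow at most like
  the powers of its mass, up to an arbitrarily small change of base. Hence `∑ Rⁿ` has finite
  weighted norm, and so has `S = B ∑ Rⁿ`.
-/

noncomputable section

namespace BGS

/-! ### Sums of extended nonnegative reals -/

section Tsum

variable {ι : Type*}

theorem rpow_tsum_le_tsum_rpow (f : ι → ℝ≥0∞) {p : ℝ} (hp : 0 < p) (hp1 : p ≤ 1) :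
    (∑' i, f i) ^ p ≤ ∑' i, f i ^ p := by
  have partial_sums : Tendsto (fun s : Finset ι => (∑ i ∈ s, f i) ^ p) atTop
      (𝓝 ((∑' i, f i) ^ p)) :=
    (ENNReal.continuous_rpow_const.tendsto _).comp ENNReal.summable.hasSum
  refine le_of_tendsto' partial_sums fun s => le_trans ?_ (ENNReal.sum_le_tsum s)
  exact Finset.le_sum_of_subadditive (· ^ p) (ENNReal.zero_rpow_of_pos hp).le
    (fun x y => ENNReal.rpow_add_le_add_rpow x y hp.le hp1) s f

theorem tsum_Lp_add_le (f g : ι → ℝ≥0∞) {p : ℝ} (hp : 1 ≤ p) :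
    (∑' i, (f i + g i) ^ p) ^ (1 / p) ≤
      (∑' i, f i ^ p) ^ (1 / p) + (∑' i, g i ^ p) ^ (1 / p) := by
  let _ : MeasurableSpace ι := ⊤
  simpa [MeasureTheory.lintegral_count] using
    ENNReal.lintegral_Lp_add_le (μ := .count) (f := f) (g := g)
      measurable_from_top.aemeasurable measurable_from_top.aemeasurable hp

theorem tsum_mul_le_Lp_mul_Lq (f g : ι → ℝ≥0∞) {p q : ℝ} (hpq : p.HolderConjugate q) :
    ∑' i, f i * g i ≤ (∑' i, f i ^ p) ^ (1 / p) * (∑' i, g i ^ q) ^ (1 / q) := by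
  let _ : MeasurableSpace ι := ⊤
  simpa [MeasureTheory.lintegral_count] using
    ENNReal.lintegral_mul_le_Lp_mul_Lq .count hpq (f := f) (g := g)
      measurable_from_top.aemeasurable measurable_from_top.aemeasurable

theorem tendsto_tsum_indicator_compl {f : ι → ℝ≥0∞} (hf : ∑' i, f i ≠ ∞) :
    Tendsto (fun s : Finset ι => ∑' i, (s : Set ι)ᶜ.indicator f i) atTop (𝓝 0) := by
  simp only [← tsum_subtype]
  exact ENNReal.tendsto_tsum_compl_atTop_zero hf

theorem tendsto_tsum_mul_zero {a : ι → ℝ≥0∞} (ha : ∑' i, a i ≠ ∞) {f : ℕ → ι → ℝ≥0∞}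
    (hf1 : ∀ n i, f n i ≤ 1) (hf : ∀ i, Tendsto (f · i) atTop (𝓝 0)) :
    Tendsto (fun n => ∑' i, a i * f n i) atTop (𝓝 0) := by
  let _ : MeasurableSpace ι := ⊤
  simp only [← MeasureTheory.lintegral_count] at ha ⊢
  have h := MeasureTheory.tendsto_lintegral_of_dominated_convergence (μ := .count)
    (F := fun n i => a i * f n i) (f := fun _ => 0) a (fun _ => measurable_from_top)
    (fun n => Eventually.of_forall fun i => mul_le_of_le_one_right' (hf1 n i)) ha
    (Eventually.of_forall fun i => by
      have ha_i : a i ≠ ∞ := by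
        rw [MeasureTheory.lintegral_count] at ha
        exact ENNReal.ne_top_of_tsum_ne_top ha i
      simpa using ENNReal.Tendsto.const_mul (hf i) (Or.inr ha_i))
  simpa using h

end Tsum

/-! ### The convolution semiring of `[0, ∞]`-valued functions on an abelian group -/

/-- Functions `G → [0, ∞]`, with convolution as multiplication and the pointwise order. -/
@[ext]
structure ConvSeq (G : Type*) where
  /-- The underlying function. -/
  toFun : G → ℝ≥0∞

namespace ConvSeq

variable {G : Type*}

instance : CoeFun (ConvSeq G) fun _ => G → ℝ≥0∞ := ⟨toFun⟩

instance : PartialOrder (ConvSeq G) := PartialOrder.lift toFun fun _ _ => ConvSeq.ext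

instance : Add (ConvSeq G) := ⟨fun a b => ⟨fun l => a l + b l⟩⟩

instance : Zero (ConvSeq G) := ⟨⟨fun _ => 0⟩⟩

instance : SMul ℝ≥0∞ (ConvSeq G) := ⟨fun c a => ⟨fun l => c * a l⟩⟩

theorem add_apply (a b : ConvSeq G) (l : G) : (a + b) l = a l + b l := rfl

theorem zero_apply (l : G) : (0 : ConvSeq G) l = 0 := rfl

theorem smul_apply (c : ℝ≥0∞) (a : ConvSeq G) (l : G) : (c • a) l = c * a l := rfl

/-- The restriction of a sequence to a set, extended by zero. -/
def restrict (s : Set G) (a : ConvSeq G) : ConvSeq G := ⟨s.indicator a⟩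

theorem restrict_apply (s : Set G) (a : ConvSeq G) (l : G) : a.restrict s l = s.indicator a l := rfl

theorem restrict_le (s : Set G) (a : ConvSeq G) : a.restrict s ≤ a := fun _ =>
  Set.indicator_le_self' (fun _ _ => zero_le) _

theorem restrict_add_restrict_compl (s : Set G) (a : ConvSeq G) :
    a.restrict s + a.restrict sᶜ = a :=
  ConvSeq.ext (s.indicator_self_add_compl a)

/-- The total mass, that is, the `ℓ¹` norm. -/
def mass (a : ConvSeq G) : ℝ≥0∞ := ∑' l, a l

theorem mass_mono {a b : ConvSeq G} (h : a ≤ b) : a.mass ≤ b.mass := ENNReal.tsum_le_tsum h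

theorem mass_smul (c : ℝ≥0∞) (a : ConvSeq G) : (c • a).mass = c * a.mass := ENNReal.tsum_mul_left

variable [AddCommGroup G]

instance : Mul (ConvSeq G) := ⟨fun a b => ⟨fun l => ∑' m, a m * b (l - m)⟩⟩

open Classical in
instance : One (ConvSeq G) := ⟨⟨fun l => if l = 0 then 1 else 0⟩⟩

theorem mul_apply (a b : ConvSeq G) (l : G) : (a * b) l = ∑' m, a m * b (l - m) := rfl

open Classical in
theorem one_apply (l : G) : (1 : ConvSeq G) l = if l = 0 then 1 else 0 := rfl

protected theorem mul_comm (a b : ConvSeq G) : a * b = b * a := by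
  ext l
  rw [mul_apply, mul_apply, ← (Equiv.subLeft l).tsum_eq]
  exact tsum_congr fun m => by simp [mul_comm]

protected theorem one_mul (a : ConvSeq G) : 1 * a = a := by
  ext l
  rw [mul_apply, tsum_eq_single 0 fun m hm => by simp [one_apply, hm]]
  simp [one_apply]

protected theorem mul_assoc (a b c : ConvSeq G) : a * b * c = a * (b * c) := by
  ext l
  simp only [mul_apply, ← ENNReal.tsum_mul_right, ← ENNReal.tsum_mul_left]
  rw [ENNReal.tsum_comm]
  refine tsum_congr fun n => ?_
  rw [← (Equiv.addRight n).tsum_eq]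
  refine tsum_congr fun m => ?_
  rw [Equiv.coe_addRight, add_sub_cancel_right, mul_assoc, sub_add_eq_sub_sub_swap]

protected theorem add_mul (a b c : ConvSeq G) : (a + b) * c = a * c + b * c := by
  ext l
  simp only [mul_apply, add_apply, add_mul, ENNReal.tsum_add]

instance : CommSemiring (ConvSeq G) where
  add_assoc a b c := by ext l; simp only [add_apply, add_assoc]
  add_comm a b := by ext l; simp only [add_apply, add_comm]
  zero_add a := by ext l; simp only [add_apply, zero_apply, zero_add]
  add_zero a := by ext l; simp only [add_apply, zero_apply, add_zero]
  mul_assoc := ConvSeq.mul_assoc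
  mul_comm := ConvSeq.mul_comm
  one_mul := ConvSeq.one_mul
  mul_one a := by rw [ConvSeq.mul_comm, ConvSeq.one_mul]
  zero_mul a := by ext l; simp [mul_apply, zero_apply]
  mul_zero a := by ext l; simp [mul_apply, zero_apply]
  right_distrib := ConvSeq.add_mul
  left_distrib a b c := by
    rw [ConvSeq.mul_comm, ConvSeq.add_mul, ConvSeq.mul_comm b, ConvSeq.mul_comm c]
  nsmul := nsmulRec

instance : IsOrderedAddMonoid (ConvSeq G) where
  add_le_add_left _ _ h c := fun l => add_le_add_left (h l) (c l)

instance : MulLeftMono (ConvSeq G) where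
  elim a _ _ h := fun l => ENNReal.tsum_le_tsum fun m => mul_le_mul_right (h (l - m)) (a m)

theorem smul_mul (c : ℝ≥0∞) (a b : ConvSeq G) : c • a * b = c • (a * b) := by
  ext l
  simp only [mul_apply, smul_apply, mul_assoc, ENNReal.tsum_mul_left]

theorem sum_apply {ι : Type*} (s : Finset ι) (f : ι → ConvSeq G) (l : G) :
    (∑ i ∈ s, f i) l = ∑ i ∈ s, f i l :=
  map_sum (⟨⟨fun a : ConvSeq G => a l, rfl⟩, fun _ _ => rfl⟩ : ConvSeq G →+ ℝ≥0∞) f s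

theorem mul_apply_le {b : ConvSeq G} {C : ℝ≥0∞} (hb : ∀ l, b l ≤ C) (a : ConvSeq G) (l : G) :
    (a * b) l ≤ a.mass * C := by
  rw [mul_apply, mass, ← ENNReal.tsum_mul_right]
  exact ENNReal.tsum_le_tsum fun m => mul_le_mul_right (hb _) _

theorem mass_one : (1 : ConvSeq G).mass = 1 := by
  simp only [mass, one_apply, tsum_ite_eq]

theorem mass_mul (a b : ConvSeq G) : (a * b).mass = a.mass * b.mass := by
  simp only [mass, mul_apply, ← ENNReal.tsum_mul_right]
  rw [ENNReal.tsum_comm]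
  refine tsum_congr fun m => ?_
  rw [ENNReal.tsum_mul_left, ← (Equiv.subRight m).tsum_eq b.toFun]
  rfl

theorem mass_pow (a : ConvSeq G) (n : ℕ) : (a ^ n).mass = a.mass ^ n := by
  induction n with
  | zero => rw [pow_zero, pow_zero, mass_one]
  | succ n ih => rw [pow_succ, pow_succ, mass_mul, ih]

/-- The pointwise product of a sequence with a weight. -/
def weighted (a : ConvSeq G) (w : G → ℝ≥0∞) : ConvSeq G := ⟨fun l => a l * w l⟩

theorem weighted_mul_le {w : G → ℝ≥0∞} (hw : ∀ x y, w (x + y) ≤ w x * w y) (a b : ConvSeq G) :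
    (a * b).weighted w ≤ a.weighted w * b.weighted w := by
  intro l
  change (∑' m, a m * b (l - m)) * w l ≤ ∑' m, a m * w m * (b (l - m) * w (l - m))
  rw [← ENNReal.tsum_mul_right]
  refine ENNReal.tsum_le_tsum fun m => ?_
  rw [mul_mul_mul_comm]
  gcongr
  simpa using hw m (l - m)

theorem weighted_pow_le {w : G → ℝ≥0∞} (hw : ∀ x y, w (x + y) ≤ w x * w y) (hw0 : w 0 ≤ 1)
    (a : ConvSeq G) (n : ℕ) : (a ^ n).weighted w ≤ a.weighted w ^ n := by
  induction n with
  | zero =>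
    intro l
    by_cases hl : l = 0 <;> simp [weighted, one_apply, hl, hw0]
  | succ n ih =>
    rw [pow_succ, pow_succ]
    exact (weighted_mul_le hw _ _).trans (mul_le_mul_left ih _)

/-- The Neumann series `∑ₙ aⁿ`. -/
def neumann (a : ConvSeq G) : ConvSeq G := ⟨fun l => ∑' n : ℕ, (a ^ n) l⟩

theorem sum_pow_le_neumann (a : ConvSeq G) (n : ℕ) : ∑ i ∈ Finset.range n, a ^ i ≤ a.neumann :=
  fun l => (sum_apply _ _ l).trans_le (ENNReal.sum_le_tsum _)

theorem mass_neumann (a : ConvSeq G) : a.neumann.mass = (1 - a.mass)⁻¹ := by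
  simp only [mass, neumann]
  rw [ENNReal.tsum_comm, ← ENNReal.tsum_geometric]
  exact tsum_congr a.mass_pow

theorem le_neumann_mul {a u f : ConvSeq G} {C : ℝ≥0∞} (hC : C ≠ ∞) (hu : ∀ l, u l ≤ C)
    (ha : a.mass < 1) (h : u ≤ f + a * u) : u ≤ a.neumann * f := by
  have iterate (n : ℕ) : u ≤ (∑ i ∈ Finset.range n, a ^ i) * f + a ^ n * u := by
    induction n with
    | zero => simp
    | succ n ih =>
      calc u ≤ (∑ i ∈ Finset.range n, a ^ i) * f + a ^ n * u := ih
        _ ≤ (∑ i ∈ Finset.range n, a ^ i) * f + a ^ n * (f + a * u) := by gcongr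
        _ = (∑ i ∈ Finset.range (n + 1), a ^ i) * f + a ^ (n + 1) * u := by
          rw [Finset.sum_range_succ]; ring
  intro l
  have remainder (n : ℕ) : u l ≤ (a.neumann * f) l + a.mass ^ n * C :=
    (iterate n l).trans <| add_le_add (mul_le_mul_left (a.sum_pow_le_neumann n) f l) <|
      (mul_apply_le hu _ l).trans_eq <| by rw [mass_pow]
  have remainder_tendsto : Tendsto (fun n => (a.neumann * f) l + a.mass ^ n * C) atTop
      (𝓝 ((a.neumann * f) l + 0 * C)) :=
    (ENNReal.Tendsto.mul_const (ENNReal.tendsto_pow_atTop_nhds_zero_of_lt_one ha)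
      (Or.inr hC)).const_add _
  rw [zero_mul, add_zero] at remainder_tendsto
  exact ge_of_tendsto' remainder_tendsto remainder

end ConvSeq

/-! ### Weighted `ℓᵖ` norms -/

section WeightedNorm

variable {G : Type*} {p : ℝ} {ν : G → ℝ≥0}

/-- The norm of the weighted space `ℓᵖ_ν`, for `p ≤ 1` the `p`-norm `∑ₗ (a_l ν(l))ᵖ`. The exponent
`min p 1 / p` is `1` in the latter case and `1 / p` otherwise. -/
def weightedNorm (p : ℝ) (ν : G → ℝ≥0) (a : ConvSeq G) : ℝ≥0∞ :=
  (∑' l, (a l * ν l) ^ p) ^ (min p 1 / p)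

theorem min_one_pos (hp : 0 < p) : 0 < min p 1 := lt_min hp one_pos

theorem weightedNorm_of_le_one (hp : 0 < p) (hp1 : p ≤ 1) (a : ConvSeq G) :
    weightedNorm p ν a = ∑' l, (a l * ν l) ^ p := by
  rw [weightedNorm, min_eq_left hp1, div_self hp.ne', ENNReal.rpow_one]

theorem weightedNorm_of_one_le (hp1 : 1 ≤ p) (a : ConvSeq G) :
    weightedNorm p ν a = (∑' l, (a l * ν l) ^ p) ^ (1 / p) := by
  rw [weightedNorm, min_eq_right hp1]

theorem weightedNorm_rpow_one_div (hp : 0 < p) (a : ConvSeq G) :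
    weightedNorm p ν a ^ (1 / min p 1) = (∑' l, (a l * ν l) ^ p) ^ (1 / p) := by
  rw [weightedNorm, ← ENNReal.rpow_mul, div_mul_div_comm, mul_comm p,
    mul_div_mul_left _ _ (min_one_pos hp).ne']

theorem weightedNorm_lt_top_iff (hp : 0 < p) {a : ConvSeq G} :
    weightedNorm p ν a < ∞ ↔ ∑' l, (a l * ν l) ^ p < ∞ :=
  ENNReal.rpow_lt_top_iff_of_pos (div_pos (min_one_pos hp) hp)

theorem weightedNorm_mono (hp : 0 < p) {a b : ConvSeq G} (h : a ≤ b) :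
    weightedNorm p ν a ≤ weightedNorm p ν b := by
  have exponent_nonneg := (div_pos (min_one_pos hp) hp).le
  exact ENNReal.rpow_le_rpow (ENNReal.tsum_le_tsum fun l =>
    ENNReal.rpow_le_rpow (mul_le_mul_left (h l) _) hp.le) exponent_nonneg

theorem weightedNorm_add_le (hp : 0 < p) (a b : ConvSeq G) :
    weightedNorm p ν (a + b) ≤ weightedNorm p ν a + weightedNorm p ν b := by
  rcases le_total p 1 with hp1 | hp1
  · simp only [weightedNorm_of_le_one hp hp1, ConvSeq.add_apply, add_mul, ← ENNReal.tsum_add]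
    exact ENNReal.tsum_le_tsum fun l => ENNReal.rpow_add_le_add_rpow _ _ hp.le hp1
  · simpa only [weightedNorm_of_one_le hp1, ConvSeq.add_apply, add_mul] using
      tsum_Lp_add_le (fun l => a l * ν l) (fun l => b l * ν l) hp1

theorem weightedNorm_smul (hp : 0 < p) (c : ℝ≥0∞) (a : ConvSeq G) :
    weightedNorm p ν (c • a) = c ^ min p 1 * weightedNorm p ν a := by
  have exponent_nonneg := (div_pos (min_one_pos hp) hp).le
  simp only [weightedNorm, ConvSeq.smul_apply, mul_assoc, ENNReal.mul_rpow_of_nonneg c _ hp.le,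
    ENNReal.tsum_mul_left]
  rw [ENNReal.mul_rpow_of_nonneg _ _ exponent_nonneg, ← ENNReal.rpow_mul,
    mul_div_cancel₀ _ hp.ne']

theorem weightedNorm_eq_zero_iff (hp : 0 < p) (hν : ∀ l, ν l ≠ 0) {a : ConvSeq G} :
    weightedNorm p ν a = 0 ↔ a = 0 := by
  rw [weightedNorm, ENNReal.rpow_eq_zero_iff_of_pos (div_pos (min_one_pos hp) hp),
    ENNReal.tsum_eq_zero, ConvSeq.ext_iff, funext_iff]
  simp only [ENNReal.rpow_eq_zero_iff_of_pos hp, mul_eq_zero, ENNReal.coe_eq_zero, hν, or_false]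
  rfl

theorem weightedNorm_restrict_lt_top (hp : 0 < p) {a : ConvSeq G} (ha : ∀ l, a l ≠ ∞)
    (s : Finset G) : weightedNorm p ν (a.restrict s) < ∞ := by
  rw [weightedNorm_lt_top_iff hp, tsum_eq_sum (s := s) fun l hl => by
    simp [ConvSeq.restrict_apply, hl, hp]]
  refine ENNReal.sum_lt_top.2 fun l _ => ENNReal.rpow_lt_top_of_nonneg hp.le <|
    ENNReal.mul_ne_top ?_ ENNReal.coe_ne_top
  exact ((a.restrict_le s l).trans_lt (ha l).lt_top).ne

theorem tendsto_weightedNorm_restrict_compl (hp : 0 < p) {a : ConvSeq G}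
    (ha : weightedNorm p ν a < ∞) :
    Tendsto (fun s : Finset G => weightedNorm p ν (a.restrict (s : Set G)ᶜ)) atTop (𝓝 0) := by
  have exponent_pos := div_pos (min_one_pos hp) hp
  have hrestrict (s : Finset G) : weightedNorm p ν (a.restrict (s : Set G)ᶜ) =
      (∑' l, (s : Set G)ᶜ.indicator (fun l => (a l * ν l) ^ p) l) ^ (min p 1 / p) := by
    refine congrArg (· ^ _) (tsum_congr fun l => ?_)
    by_cases hl : l ∈ s <;> simp [ConvSeq.restrict_apply, hl, hp]
  simp only [hrestrict]
  have hrpow := (ENNReal.continuous_rpow_const (y := min p 1 / p)).tendsto 0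
  rw [ENNReal.zero_rpow_of_pos exponent_pos] at hrpow
  exact hrpow.comp (tendsto_tsum_indicator_compl ((weightedNorm_lt_top_iff hp).1 ha).ne)

theorem exists_mass_le_mul_weightedNorm_rpow (hp : 0 < p) (hν : ∀ l, 1 ≤ ν l)
    (hpν : 1 < p → ∑' n, (ν n : ℝ≥0∞) ^ (-p.conjExponent) < ∞) :
    ∃ K ≠ ∞, ∀ a : ConvSeq G, a.mass ≤ K * weightedNorm p ν a ^ (1 / min p 1) := by
  simp only [weightedNorm_rpow_one_div hp]
  rcases le_or_gt p 1 with h | h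
  · refine ⟨1, ENNReal.one_ne_top, fun a => ?_⟩
    rw [one_mul, one_div, ENNReal.le_rpow_inv_iff hp]
    refine (rpow_tsum_le_tsum_rpow a hp h).trans (ENNReal.tsum_le_tsum fun l => ?_)
    exact ENNReal.rpow_le_rpow (le_mul_of_one_le_right' (by exact_mod_cast hν l)) hp.le
  · have hc : p.HolderConjugate p.conjExponent := .conjExponent h
    have hq : 0 ≤ 1 / p.conjExponent := one_div_nonneg.2 hc.symm.nonneg
    refine ⟨(∑' n, (ν n : ℝ≥0∞) ^ (-p.conjExponent)) ^ (1 / p.conjExponent),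
      ENNReal.rpow_ne_top_of_nonneg hq (hpν h).ne, fun a => ?_⟩
    have hν0 (l : G) : (ν l : ℝ≥0∞) ≠ 0 := by exact_mod_cast (one_pos.trans_le (hν l)).ne'
    calc a.mass = ∑' l, (ν l : ℝ≥0∞)⁻¹ * (a l * ν l) := tsum_congr fun l => by
          rw [mul_left_comm, ENNReal.inv_mul_cancel (hν0 l) ENNReal.coe_ne_top, mul_one]
      _ ≤ (∑' l, (ν l : ℝ≥0∞)⁻¹ ^ p.conjExponent) ^ (1 / p.conjExponent) *
          (∑' l, (a l * ν l) ^ p) ^ (1 / p) := tsum_mul_le_Lp_mul_Lq _ _ hc.symm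
      _ = _ := by simp only [ENNReal.inv_rpow, ENNReal.rpow_neg]

theorem mass_lt_top_of_weightedNorm_lt_top (hp : 0 < p) (hν : ∀ l, 1 ≤ ν l)
    (hpν : 1 < p → ∑' n, (ν n : ℝ≥0∞) ^ (-p.conjExponent) < ∞) {a : ConvSeq G}
    (ha : weightedNorm p ν a < ∞) : a.mass < ∞ := by
  obtain ⟨K, hK, h⟩ := exists_mass_le_mul_weightedNorm_rpow hp hν hpν
  exact (h a).trans_lt (ENNReal.mul_lt_top hK.lt_top
    (ENNReal.rpow_lt_top_of_nonneg (one_div_nonneg.2 (min_one_pos hp).le) ha.ne))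

variable [AddCommGroup G]

theorem weightedNorm_reflect (hν : ∀ l, ν (-l) = ν l) (a : ConvSeq G) :
    weightedNorm p ν ⟨fun l => a (-l)⟩ = weightedNorm p ν a := by
  rw [weightedNorm, ← (Equiv.neg G).tsum_eq]
  simp [weightedNorm, hν]

theorem mul_apply_mul_weight_rpow_le_of_le_one (hp : 0 < p) (hp1 : p ≤ 1)
    (hsub : ∀ x y, ν (x + y) ≤ ν x * ν y) (a b : ConvSeq G) (l : G) :
    ((a * b) l * ν l) ^ p ≤ ∑' m, (a m * ν m) ^ p * (b (l - m) * ν (l - m)) ^ p := by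
  refine (ENNReal.rpow_le_rpow (ConvSeq.weighted_mul_le (w := fun l => ν l)
    (fun x y => by exact_mod_cast hsub x y) a b l) hp.le).trans ?_
  refine (rpow_tsum_le_tsum_rpow _ hp hp1).trans_eq (tsum_congr fun m => ?_)
  exact ENNReal.mul_rpow_of_nonneg _ _ hp.le

theorem mul_apply_mul_weight_rpow_le_of_one_lt (hp1 : 1 < p) (hν : ∀ l, ν l ≠ 0)
    (halg : ∀ n, ∑' m, (ν m : ℝ≥0∞) ^ (-p.conjExponent) * (ν (n - m) : ℝ≥0∞) ^ (-p.conjExponent)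
      ≤ (ν n : ℝ≥0∞) ^ (-p.conjExponent)) (a b : ConvSeq G) (l : G) :
    ((a * b) l * ν l) ^ p ≤ ∑' m, (a m * ν m) ^ p * (b (l - m) * ν (l - m)) ^ p := by
  have hc : p.HolderConjugate p.conjExponent := .conjExponent hp1
  have hν0 (l : G) : (ν l : ℝ≥0∞) ≠ 0 := by exact_mod_cast hν l
  have cancel (x : ℝ≥0∞) (l : G) : (x * ν l) * (ν l : ℝ≥0∞)⁻¹ = x := by
    rw [mul_assoc, ENNReal.mul_inv_cancel (hν0 l) ENNReal.coe_ne_top, mul_one]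
  have weights_le : (∑' m, ((ν m : ℝ≥0∞)⁻¹ * (ν (l - m) : ℝ≥0∞)⁻¹) ^ p.conjExponent) ^
      (1 / p.conjExponent) ≤ (ν l : ℝ≥0∞)⁻¹ := by
    rw [one_div, ENNReal.rpow_inv_le_iff hc.symm.pos]
    simpa only [ENNReal.mul_rpow_of_nonneg _ _ hc.symm.nonneg, ENNReal.inv_rpow,
      ENNReal.rpow_neg] using halg l
  have holder : (a * b) l ≤
      (∑' m, (a m * ν m) ^ p * (b (l - m) * ν (l - m)) ^ p) ^ (1 / p) * (ν l : ℝ≥0∞)⁻¹ :=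
    calc (a * b) l
        = ∑' m, ((a m * ν m) * (b (l - m) * ν (l - m))) *
            ((ν m : ℝ≥0∞)⁻¹ * (ν (l - m) : ℝ≥0∞)⁻¹) := tsum_congr fun m => by
          rw [mul_mul_mul_comm, cancel, cancel]
      _ ≤ (∑' m, ((a m * ν m) * (b (l - m) * ν (l - m))) ^ p) ^ (1 / p) * _ :=
          tsum_mul_le_Lp_mul_Lq _ _ hc
      _ ≤ _ := by
          simp only [ENNReal.mul_rpow_of_nonneg (_ * _) (_ * _) hc.nonneg]
          gcongr
  calc ((a * b) l * ν l) ^ p ≤ (_ * (ν l : ℝ≥0∞)⁻¹ * ν l) ^ p := by gcongr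
    _ = _ := by
      rw [mul_assoc, ENNReal.inv_mul_cancel (hν0 l) ENNReal.coe_ne_top, mul_one,
        ← ENNReal.rpow_mul, one_div_mul_cancel hc.pos.ne', ENNReal.rpow_one]

theorem weightedNorm_mul_le (hp : 0 < p) (hν : ∀ l, ν l ≠ 0)
    (hsub : ∀ x y, ν (x + y) ≤ ν x * ν y)
    (halg : 1 < p → ∀ n, ∑' m, (ν m : ℝ≥0∞) ^ (-p.conjExponent) *
      (ν (n - m) : ℝ≥0∞) ^ (-p.conjExponent) ≤ (ν n : ℝ≥0∞) ^ (-p.conjExponent))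
    (a b : ConvSeq G) :
    weightedNorm p ν (a * b) ≤ weightedNorm p ν a * weightedNorm p ν b := by
  have exponent_nonneg := (div_pos (min_one_pos hp) hp).le
  let powers (c : ConvSeq G) : ConvSeq G := ⟨fun l => (c l * ν l) ^ p⟩
  have pointwise : powers (a * b) ≤ powers a * powers b := by
    rcases le_or_gt p 1 with hp1 | hp1
    · exact mul_apply_mul_weight_rpow_le_of_le_one hp hp1 hsub a b
    · exact mul_apply_mul_weight_rpow_le_of_one_lt hp1 hν (halg hp1) a b
  have masses : (powers (a * b)).mass ≤ (powers a).mass * (powers b).mass :=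
    (ConvSeq.mass_mono pointwise).trans_eq (ConvSeq.mass_mul _ _)
  exact (ENNReal.rpow_le_rpow masses exponent_nonneg).trans_eq
    (ENNReal.mul_rpow_of_nonneg _ _ exponent_nonneg)

end WeightedNorm

/-! ### Admissible weights grow subexponentially -/

theorem tsum_prod_apply {α : Type*} (f : α → ℝ≥0∞) (d : ℕ) :
    ∑' l : Fin d → α, ∏ i, f (l i) = (∑' x, f x) ^ d := by
  induction d with
  | zero => simp
  | succ d ih =>
    have prod_cons (c : α × (Fin d → α)) :
        ∏ i, f (Fin.consEquiv (fun _ => α) c i) = f c.1 * ∏ i, f (c.2 i) := by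
      simp [Fin.consEquiv, Fin.prod_univ_succ]
    rw [← (Fin.consEquiv fun _ : Fin (d + 1) => α).tsum_eq, tsum_congr prod_cons,
      ENNReal.tsum_prod (f := fun x (l : Fin d → α) => f x * ∏ i, f (l i)), pow_succ', ← ih,
      ← ENNReal.tsum_mul_right]
    exact tsum_congr fun x => ENNReal.tsum_mul_left

theorem tsum_pow_natAbs_lt_top {t : ℝ≥0∞} (ht : t < 1) : ∑' z : ℤ, t ^ z.natAbs < ∞ := by
  have geometric : ∑' n : ℕ, t ^ n < ∞ := by
    rw [ENNReal.tsum_geometric]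
    exact ENNReal.inv_lt_top.2 (tsub_pos_of_lt ht)
  have natAbs_neg_add_one (n : ℕ) : (-((n : ℤ) + 1)).natAbs = n + 1 := by omega
  rw [tsum_of_nat_of_neg_add_one ENNReal.summable ENNReal.summable]
  simp only [Int.natAbs_natCast, natAbs_neg_add_one]
  exact ENNReal.add_lt_top.2 ⟨geometric, (ENNReal.tsum_comp_le_tsum_of_injective
    (add_left_injective 1) (fun n : ℕ => t ^ n)).trans_lt geometric⟩

section Weights

variable {d : ℕ} {ν : (Fin d → ℤ) → ℝ≥0}

theorem IsAdmissible.one_le_zero (hν : IsAdmissible ν) : 1 ≤ ν 0 := by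
  have h0 : ν 0 ≠ 0 := by
    intro h
    refine zero_ne_one (tendsto_nhds_unique (tendsto_const_nhds.congr' ?_) (hν.grs 0))
    filter_upwards [eventually_ne_atTop 0] with n hn
    rw [smul_zero, h, NNReal.zero_rpow (one_div_ne_zero (Nat.cast_ne_zero.2 hn))]
  have hsq := hν.submul 0 0
  rw [add_zero] at hsq
  exact le_of_mul_le_mul_right (by rwa [one_mul]) (pos_iff_ne_zero.2 h0)

theorem IsAdmissible.one_le (hν : IsAdmissible ν) (x : Fin d → ℤ) : 1 ≤ ν x := by
  have hsq := hν.submul x (-x)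
  rw [add_neg_cancel, hν.symm] at hsq
  by_contra! hx
  exact (hν.one_le_zero.trans hsq).not_gt (mul_lt_one_of_nonneg_of_lt_one_left zero_le hx hx.le)

theorem IsAdmissible.ne_zero (hν : IsAdmissible ν) (x : Fin d → ℤ) : ν x ≠ 0 :=
  (one_pos.trans_le (hν.one_le x)).ne'

theorem IsAdmissible.exists_nsmul_le (hν : IsAdmissible ν) (x : Fin d → ℤ) {q : ℝ≥0}
    (hq : 1 < q) : ∃ C : ℝ≥0, ∀ n : ℕ, ν (n • x) ≤ C * q ^ n := by
  obtain ⟨n₀, hn₀⟩ := eventually_atTop.1 ((hν.grs x).eventually (gt_mem_nhds hq))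
  refine ⟨1 + ∑ n ∈ Finset.range (n₀ + 1), ν (n • x), fun n => ?_⟩
  rcases le_or_gt n n₀ with h | h
  · calc ν (n • x) ≤ ∑ n ∈ Finset.range (n₀ + 1), ν (n • x) :=
        Finset.single_le_sum (f := fun n : ℕ => ν (n • x)) (fun _ _ => zero_le)
          (Finset.mem_range_succ_iff.2 h)
      _ ≤ 1 + ∑ n ∈ Finset.range (n₀ + 1), ν (n • x) := le_add_self
      _ ≤ _ := le_mul_of_one_le_right zero_le (one_le_pow₀ hq.le)
  · have hn : (0 : ℝ) < n := by exact_mod_cast (Nat.zero_le n₀).trans_lt h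
    have hroot := (hn₀ n h.le).le
    rw [one_div, NNReal.rpow_inv_le_iff hn, NNReal.rpow_natCast] at hroot
    exact hroot.trans (le_mul_of_one_le_left zero_le le_self_add)

/-- The exponential weight `q^(|l₁| + ⋯ + |l_d|)`, with which admissible weights are compared. -/
def expWeight (q : ℝ≥0) (l : Fin d → ℤ) : ℝ≥0 := ∏ i, q ^ (l i).natAbs

theorem expWeight_one (l : Fin d → ℤ) : expWeight 1 l = 1 := by simp [expWeight]

theorem expWeight_zero (q : ℝ≥0) : expWeight q (0 : Fin d → ℤ) = 1 := by simp [expWeight]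

theorem expWeight_ne_zero {q : ℝ≥0} (hq : q ≠ 0) (l : Fin d → ℤ) : expWeight q l ≠ 0 :=
  Finset.prod_ne_zero_iff.2 fun _ _ => pow_ne_zero _ hq

theorem expWeight_mul (q r : ℝ≥0) (l : Fin d → ℤ) :
    expWeight (q * r) l = expWeight q l * expWeight r l := by
  simp only [expWeight, mul_pow, Finset.prod_mul_distrib]

theorem expWeight_add_le {q : ℝ≥0} (hq : 1 ≤ q) (x y : Fin d → ℤ) :
    expWeight q (x + y) ≤ expWeight q x * expWeight q y := by
  simp only [expWeight, ← Finset.prod_mul_distrib, ← pow_add]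
  exact Finset.prod_le_prod' fun i _ => pow_le_pow_right₀ hq (Int.natAbs_add_le _ _)

theorem continuous_expWeight (l : Fin d → ℤ) : Continuous fun q => expWeight q l := by
  unfold expWeight
  fun_prop

theorem IsAdmissible.exists_le_expWeight (hν : IsAdmissible ν) {q : ℝ≥0} (hq : 1 < q) :
    ∃ C : ℝ≥0, ∀ l, ν l ≤ C * expWeight q l := by
  choose C hC using fun i : Fin d => hν.exists_nsmul_le (Pi.single i 1) hq
  have axis (i : Fin d) (z : ℤ) : ν (Pi.single i z) ≤ C i * q ^ z.natAbs := by
    have h := hC i z.natAbs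
    rw [← Pi.single_smul, nsmul_one] at h
    rcases Int.natAbs_eq z with hz | hz
    · rwa [← hz] at h
    · rwa [hz, Pi.single_neg, hν.symm, Int.natAbs_neg, Int.natAbs_natCast]
  have partial_sum (s : Finset (Fin d)) (l : Fin d → ℤ) :
      ν (∑ i ∈ s, Pi.single i (l i)) ≤ ν 0 * ∏ i ∈ s, (C i * q ^ (l i).natAbs) := by
    induction s using Finset.induction_on with
    | empty => simp
    | insert a s ha ih =>
      rw [Finset.sum_insert ha, Finset.prod_insert ha, mul_left_comm]
      exact (hν.submul _ _).trans (mul_le_mul' (axis _ _) ih)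
  refine ⟨ν 0 * ∏ i, C i, fun l => ?_⟩
  simpa only [expWeight, Finset.univ_sum_single, Finset.prod_mul_distrib, ← mul_assoc] using
    partial_sum Finset.univ l

theorem tsum_expWeight_rpow_neg_lt_top {q : ℝ≥0} (hq : 1 < q) {p : ℝ} (hp : 0 < p) :
    ∑' l : Fin d → ℤ, (expWeight q l : ℝ≥0∞) ^ (-p) < ∞ := by
  have hq1 : (q : ℝ≥0∞) ^ (-p) < 1 := by
    rw [ENNReal.rpow_neg]
    exact ENNReal.inv_lt_one.2 (ENNReal.one_lt_rpow (by exact_mod_cast hq) hp)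
  have hprod (l : Fin d → ℤ) :
      (expWeight q l : ℝ≥0∞) ^ (-p) = ∏ i, ((q : ℝ≥0∞) ^ (-p)) ^ (l i).natAbs := by
    rw [expWeight, ENNReal.ofNNReal_finsetProd,
      ← ENNReal.prod_rpow_of_ne_top fun _ _ => ENNReal.coe_ne_top]
    refine Finset.prod_congr rfl fun i _ => ?_
    rw [ENNReal.coe_pow, ← ENNReal.rpow_natCast_mul, ← ENNReal.rpow_mul_natCast, mul_comm]
  simp only [hprod]
  rw [tsum_prod_apply fun z : ℤ => ((q : ℝ≥0∞) ^ (-p)) ^ z.natAbs]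
  exact ENNReal.pow_lt_top (tsum_pow_natAbs_lt_top hq1)

end Weights

/-! ### The spectral radius in the weighted convolution algebra -/

section SpectralRadius

variable {d : ℕ} {p : ℝ} {ν : (Fin d → ℤ) → ℝ≥0}

theorem weightedNorm_expWeight_inv_lt_top (hp : 0 < p) (hν : IsAdmissible ν) {q : ℝ≥0}
    (hq : 1 < q) : weightedNorm p ν ⟨fun l => (expWeight q l : ℝ≥0∞)⁻¹⟩ < ∞ := by
  have hr : 1 < NNReal.sqrt q := by rwa [← NNReal.sqrt_one, NNReal.sqrt_lt_sqrt]
  obtain ⟨C, hC⟩ := hν.exists_le_expWeight hr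
  rw [weightedNorm_lt_top_iff hp]
  calc ∑' l, ((expWeight q l : ℝ≥0∞)⁻¹ * ν l) ^ p
      ≤ ∑' l, (C : ℝ≥0∞) ^ p * (expWeight (NNReal.sqrt q) l : ℝ≥0∞) ^ (-p) := by
        refine ENNReal.tsum_le_tsum fun l => ?_
        have hw0 : (expWeight (NNReal.sqrt q) l : ℝ≥0∞) ≠ 0 := by
          exact_mod_cast expWeight_ne_zero (one_pos.trans hr).ne' l
        rw [ENNReal.rpow_neg, ← ENNReal.inv_rpow, ← ENNReal.mul_rpow_of_nonneg _ _ hp.le]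
        refine ENNReal.rpow_le_rpow ?_ hp.le
        rw [← ENNReal.div_eq_inv_mul, ← div_eq_mul_inv]
        nth_rw 1 [← NNReal.mul_self_sqrt q]
        rw [expWeight_mul, ENNReal.coe_mul]
        have hνC : (ν l : ℝ≥0∞) ≤ C * expWeight (NNReal.sqrt q) l := by exact_mod_cast hC l
        exact (ENNReal.div_le_div_right hνC _).trans_eq
          (ENNReal.mul_div_mul_right _ _ hw0 ENNReal.coe_ne_top)
    _ = (C : ℝ≥0∞) ^ p * ∑' l : Fin d → ℤ, (expWeight (NNReal.sqrt q) l : ℝ≥0∞) ^ (-p) :=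
        ENNReal.tsum_mul_left
    _ < ∞ := ENNReal.mul_lt_top (ENNReal.rpow_lt_top_of_nonneg hp.le ENNReal.coe_ne_top)
        (tsum_expWeight_rpow_neg_lt_top hr hp)

theorem exists_mass_weighted_expWeight_lt {a : ConvSeq (Fin d → ℤ)} (s : Finset (Fin d → ℤ))
    {ρ : ℝ≥0∞} (ha : a.mass < ρ) :
    ∃ q : ℝ≥0, 1 < q ∧ ((a.restrict s).weighted fun l => expWeight q l).mass < ρ := by
  have ha_top (l : Fin d → ℤ) : a l ≠ ∞ := ENNReal.ne_top_of_tsum_ne_top (ha.trans_le le_top).ne l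
  have mass_eq (q : ℝ≥0) : ((a.restrict s).weighted fun l => expWeight q l).mass =
      ∑ l ∈ s, a l * expWeight q l := by
    refine (tsum_eq_sum fun l hl => ?_).trans (Finset.sum_congr rfl fun l hl => ?_) <;>
      simp [ConvSeq.weighted, ConvSeq.restrict_apply, hl]
  have mass_continuous : Continuous fun q : ℝ≥0 => ∑ l ∈ s, a l * (expWeight q l : ℝ≥0∞) :=
    continuous_finsetSum _ fun l _ => (ENNReal.continuous_const_mul (ha_top l)).comp
      (ENNReal.continuous_coe.comp (continuous_expWeight l))
  have at_one : ∑ l ∈ s, a l * (expWeight 1 l : ℝ≥0∞) < ρ := by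
    simp only [expWeight_one, ENNReal.coe_one, mul_one]
    exact (ENNReal.sum_le_tsum s).trans_lt ha
  have near_one := mass_continuous.continuousAt.eventually (gt_mem_nhds at_one)
  have above_one : ∀ᶠ q : ℝ≥0 in 𝓝[>] 1, 1 < q := self_mem_nhdsWithin
  simp only [mass_eq]
  exact (above_one.and (near_one.filter_mono nhdsWithin_le_nhds)).exists

theorem exists_weightedNorm_restrict_pow_le (hp : 0 < p) (hν : IsAdmissible ν)
    {a : ConvSeq (Fin d → ℤ)} (s : Finset (Fin d → ℤ)) {ρ : ℝ≥0∞} (ha : a.mass < ρ) :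
    ∃ C ≠ ∞, ∀ n : ℕ, weightedNorm p ν (a.restrict s ^ n) ≤ C * (ρ ^ min p 1) ^ n := by
  obtain ⟨q, hq, hmass⟩ := exists_mass_weighted_expWeight_lt s ha
  refine ⟨_, (weightedNorm_expWeight_inv_lt_top hp hν hq).ne, fun n => ?_⟩
  have pointwise : a.restrict s ^ n ≤ ρ ^ n • ⟨fun l => (expWeight q l : ℝ≥0∞)⁻¹⟩ := by
    intro l
    have hw0 : (expWeight q l : ℝ≥0∞) ≠ 0 := by
      exact_mod_cast expWeight_ne_zero (one_pos.trans hq).ne' l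
    rw [ConvSeq.smul_apply, ← div_eq_mul_inv,
      ENNReal.le_div_iff_mul_le (Or.inl hw0) (Or.inl ENNReal.coe_ne_top)]
    calc (a.restrict s ^ n) l * expWeight q l
        ≤ ((a.restrict s ^ n).weighted fun l => expWeight q l).mass :=
          ENNReal.le_tsum (f := fun l => (a.restrict s ^ n) l * (expWeight q l : ℝ≥0∞)) l
      _ ≤ (((a.restrict s).weighted fun l => expWeight q l) ^ n).mass :=
          ConvSeq.mass_mono <| ConvSeq.weighted_pow_le
            (fun x y => by exact_mod_cast expWeight_add_le hq.le x y)
            (by rw [expWeight_zero, ENNReal.coe_one]) _ n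
      _ ≤ ρ ^ n := by
          rw [ConvSeq.mass_pow]
          exact pow_le_pow_left' hmass.le n
  refine (weightedNorm_mono hp pointwise).trans_eq ?_
  rw [weightedNorm_smul hp, mul_comm, ← ENNReal.rpow_natCast_mul, ← ENNReal.rpow_mul_natCast,
    mul_comm (n : ℝ)]

theorem weightedNorm_pow_mul_add_pow_le {G : Type*} [AddCommGroup G] {ν : G → ℝ≥0} (hp : 0 < p)
    (hmul : ∀ a b : ConvSeq G, weightedNorm p ν (a * b) ≤ weightedNorm p ν a * weightedNorm p ν b)
    {b c : ConvSeq G} {C σ ε : ℝ≥0∞} (hb : ∀ m : ℕ, weightedNorm p ν (b ^ m) ≤ C * σ ^ m)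
    (hc : weightedNorm p ν c ≤ ε) (m n : ℕ) :
    weightedNorm p ν (b ^ m * (b + c) ^ n) ≤ C * σ ^ m * (σ + ε) ^ n := by
  induction n generalizing m with
  | zero => simpa using hb m
  | succ n ih =>
    calc weightedNorm p ν (b ^ m * (b + c) ^ (n + 1))
        = weightedNorm p ν (b ^ (m + 1) * (b + c) ^ n + c * (b ^ m * (b + c) ^ n)) := by
          congr 1
          ring
      _ ≤ C * σ ^ (m + 1) * (σ + ε) ^ n + ε * (C * σ ^ m * (σ + ε) ^ n) :=
          (weightedNorm_add_le hp _ _).trans <| add_le_add (ih (m + 1)) <|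
            (hmul _ _).trans (mul_le_mul' hc (ih m))
      _ = C * σ ^ m * (σ + ε) ^ (n + 1) := by ring

/-- The spectral radius in the weighted algebra is at most the `ℓ¹` norm: on the finitely supported
part exponential weights beat `ν`, and the remainder is a small perturbation. -/
theorem tsum_weightedNorm_pow_lt_top (hp : 0 < p) (hν : IsAdmissible ν)
    (hpν : 1 < p → IsPAlgebraWeight p ν) {a : ConvSeq (Fin d → ℤ)} (ha : weightedNorm p ν a < ∞)
    (ha1 : a.mass < 1) : ∑' n : ℕ, weightedNorm p ν (a ^ n) < ∞ := by
  obtain ⟨ρ, hρ, hρ1⟩ := exists_between ha1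
  obtain ⟨τ, hτ, hτ1⟩ := exists_between (ENNReal.rpow_lt_one hρ1 (min_one_pos hp))
  obtain ⟨s, hs⟩ := ((tendsto_weightedNorm_restrict_compl hp ha).eventually
    (gt_mem_nhds (tsub_pos_of_lt hτ))).exists
  obtain ⟨C, hC, hpow⟩ := exists_weightedNorm_restrict_pow_le hp hν s hρ
  have growth (n : ℕ) : weightedNorm p ν (a ^ n) ≤ C * τ ^ n := by
    simpa [a.restrict_add_restrict_compl, add_tsub_cancel_of_le hτ.le] using
      weightedNorm_pow_mul_add_pow_le hp (weightedNorm_mul_le hp hν.ne_zero hν.submul hpν)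
        hpow hs.le 0 n
  refine (ENNReal.tsum_le_tsum growth).trans_lt ?_
  rw [ENNReal.tsum_mul_left, ENNReal.tsum_geometric]
  exact ENNReal.mul_lt_top hC.lt_top (ENNReal.inv_lt_top.2 (tsub_pos_of_lt hτ1))

end SpectralRadius

/-! ### Decay of the side diagonals of an operator -/

section Operators

variable {d : ℕ} {H : Type*} [NormedAddCommGroup H] [InnerProductSpace ℂ H]

/-- The sequence of the suprema of the norms along the side diagonals of a matrix. -/
def diagSup (A : OpMatrix d H) : ConvSeq (Fin d → ℤ) := ⟨fun l => ⨆ k, ‖A k (k - l)‖ₑ⟩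

theorem diagSup_apply (A : OpMatrix d H) (l : Fin d → ℤ) :
    diagSup A l = ⨆ k, ‖A k (k - l)‖ₑ := rfl

theorem enorm_le_diagSup (A : OpMatrix d H) (k l : Fin d → ℤ) :
    ‖A k (k - l)‖ₑ ≤ diagSup A l :=
  le_iSup (fun k => ‖A k (k - l)‖ₑ) k

theorem diagSup_ne_top {A : OpMatrix d H} (hA : (diagSup A).mass ≠ ∞) (l : Fin d → ℤ) :
    diagSup A l ≠ ∞ :=
  ENNReal.ne_top_of_tsum_ne_top hA l

/-- The off-diagonal decay of an operator: the sequence `diagSup` of its canonical matrix. -/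
def decay (T : L2 d H →L[ℂ] L2 d H) : ConvSeq (Fin d → ℤ) := diagSup (canonicalMatrix T)

theorem enorm_canonicalMatrix_le_decay (T : L2 d H →L[ℂ] L2 d H) (k l : Fin d → ℤ) :
    ‖canonicalMatrix T k (k - l)‖ₑ ≤ decay T l :=
  enorm_le_diagSup _ k l

theorem canonicalMatrix_apply (T : L2 d H →L[ℂ] L2 d H) (k l : Fin d → ℤ) (v : H) :
    canonicalMatrix T k l v = T (lp.single 2 l v) k := rfl

theorem canonicalMatrix_injective :
    Function.Injective (canonicalMatrix : (L2 d H →L[ℂ] L2 d H) → OpMatrix d H) := by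
  intro S T h
  ext x : 1
  refine lp.ext (funext fun k => ?_)
  exact ((canonicalMatrix_eq_iff S _).1 h x k).unique ((canonicalMatrix_eq_iff T _).1 rfl x k)

theorem canonicalMatrix_sub (S T : L2 d H →L[ℂ] L2 d H) :
    canonicalMatrix (S - T) = canonicalMatrix S - canonicalMatrix T := by
  funext k l
  ext v
  simp [canonicalMatrix_apply]

theorem canonicalMatrix_one_apply (k l : Fin d → ℤ) :
    canonicalMatrix (1 : L2 d H →L[ℂ] L2 d H) k l = if k = l then 1 else 0 := by
  ext v
  rw [canonicalMatrix_apply]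
  split_ifs with h
  · subst h
    simp
  · simpa using lp.single_apply_ne (E := fun _ : Fin d → ℤ => H) 2 l v h

theorem continuous_canonicalMatrix_apply (k l : Fin d → ℤ) :
    Continuous fun T : L2 d H →L[ℂ] L2 d H => canonicalMatrix T k l := by
  unfold canonicalMatrix
  fun_prop

theorem diagSup_add_le (A B : OpMatrix d H) : diagSup (A + B) ≤ diagSup A + diagSup B := fun l =>
  iSup_le fun k => (enorm_add_le (A k (k - l)) (B k (k - l))).trans
    (add_le_add (enorm_le_diagSup A k l) (enorm_le_diagSup B k l))

theorem decay_add_le (S T : L2 d H →L[ℂ] L2 d H) : decay (S + T) ≤ decay S + decay T :=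
  diagSup_add_le (canonicalMatrix S) (canonicalMatrix T)

theorem decay_smul (c : ℂ) (T : L2 d H →L[ℂ] L2 d H) : decay (c • T) = ‖c‖ₑ • decay T := by
  ext l
  rw [ConvSeq.smul_apply, decay, decay, diagSup_apply, diagSup_apply, ENNReal.mul_iSup]
  exact iSup_congr fun k => enorm_smul c (canonicalMatrix T k (k - l))

theorem decay_eq_zero_iff {T : L2 d H →L[ℂ] L2 d H} : decay T = 0 ↔ T = 0 := by
  constructor
  · intro h
    refine canonicalMatrix_injective (funext₂ fun k l => ?_)
    have hle := enorm_canonicalMatrix_le_decay T k (k - l)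
    rw [h, sub_sub_cancel, ConvSeq.zero_apply, nonpos_iff_eq_zero] at hle
    exact enorm_eq_zero (E := H →L[ℂ] H).1 hle
  · rintro rfl
    simpa [ConvSeq.ext_iff, funext_iff, ConvSeq.smul_apply, ConvSeq.zero_apply] using
      decay_smul 0 (0 : L2 d H →L[ℂ] L2 d H)

theorem decay_one_le : decay (1 : L2 d H →L[ℂ] L2 d H) ≤ 1 := by
  refine fun l => iSup_le fun k => ?_
  rw [canonicalMatrix_one_apply, ConvSeq.one_apply]
  by_cases hl : l = 0
  · simp only [hl, sub_zero, if_true]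
    exact ContinuousLinearMap.opENorm_le_bound _ fun v => by simp
  · rw [if_neg fun h => hl (by simpa using h.symm), if_neg hl]
    exact (enorm_zero (E := H →L[ℂ] H)).le

theorem decay_mul_le (S T : L2 d H →L[ℂ] L2 d H) : decay (S * T) ≤ decay S * decay T := by
  refine fun l => iSup_le fun k => ContinuousLinearMap.opENorm_le_bound _ fun v => ?_
  rw [← (hasSum_canonicalMatrix_mul S T k (k - l) v).tsum_eq, ConvSeq.mul_apply,
    ← ENNReal.tsum_mul_right, ← (Equiv.subLeft k).tsum_eq]
  refine enorm_tsum_le_tsum_enorm.trans (ENNReal.tsum_le_tsum fun m => ?_)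
  have entry_T := enorm_canonicalMatrix_le_decay T (k - m) (l - m)
  rw [sub_sub_sub_cancel_right] at entry_T
  rw [Equiv.subLeft_apply, mul_assoc]
  exact (ContinuousLinearMap.le_opENorm _ _).trans <|
    mul_le_mul' (enorm_canonicalMatrix_le_decay S k m) <|
      (ContinuousLinearMap.le_opENorm _ _).trans (mul_le_mul_left entry_T _)

theorem decay_pow_le (T : L2 d H →L[ℂ] L2 d H) (n : ℕ) : decay (T ^ n) ≤ decay T ^ n := by
  induction n with
  | zero => exact decay_one_le
  | succ n ih =>
    rw [pow_succ, pow_succ]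
    exact (decay_mul_le _ _).trans (mul_le_mul_left ih _)

theorem decay_star [CompleteSpace H] (T : L2 d H →L[ℂ] L2 d H) :
    decay (star T) = ⟨fun l => decay T (-l)⟩ := by
  ext l
  change ⨆ k, _ = ⨆ k, _
  rw [← (Equiv.addRight l).iSup_comp]
  refine iSup_congr fun k => ?_
  rw [canonicalMatrix_star, Equiv.coe_addRight, add_sub_cancel_right, sub_neg_eq_add,
    ← ofReal_norm, norm_star, ofReal_norm]

/-! ### Operators defined by matrices with summable diagonals -/

section Reindex

variable {α β E F : Type*} [NormedAddCommGroup E] [NormedAddCommGroup F] {p : ℝ≥0∞}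

theorem sum_norm_rpow_le_of_norm_le_comp (hp : 0 < p.toReal) {x : α → E}
    {y : lp (fun _ : β => F) p} {c : ℝ} (hc : 0 ≤ c) (e : α ≃ β)
    (h : ∀ k, ‖x k‖ ≤ c * ‖y (e k)‖) (s : Finset α) :
    ∑ k ∈ s, ‖x k‖ ^ p.toReal ≤ (c * ‖y‖) ^ p.toReal :=
  calc ∑ k ∈ s, ‖x k‖ ^ p.toReal
      ≤ ∑ k ∈ s, c ^ p.toReal * ‖y (e k)‖ ^ p.toReal := Finset.sum_le_sum fun k _ => by
        rw [← Real.mul_rpow hc (norm_nonneg _)]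
        exact Real.rpow_le_rpow (norm_nonneg _) (h k) hp.le
    _ = c ^ p.toReal * ∑ k ∈ s.map e.toEmbedding, ‖y k‖ ^ p.toReal := by
        rw [Finset.sum_map, Finset.mul_sum]
        rfl
    _ ≤ c ^ p.toReal * ‖y‖ ^ p.toReal := by
        gcongr
        exact lp.sum_rpow_le_norm_rpow hp y _
    _ = (c * ‖y‖) ^ p.toReal := (Real.mul_rpow hc (lp.norm_nonneg' y)).symm

theorem memℓp_of_norm_le_comp (hp : 0 < p.toReal) {x : α → E} {y : lp (fun _ : β => F) p} {c : ℝ}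
    (hc : 0 ≤ c) (e : α ≃ β) (h : ∀ k, ‖x k‖ ≤ c * ‖y (e k)‖) : Memℓp x p :=
  memℓp_gen' (sum_norm_rpow_le_of_norm_le_comp hp hc e h)

theorem norm_le_of_norm_le_comp (hp : 0 < p.toReal) {x : lp (fun _ : α => E) p}
    {y : lp (fun _ : β => F) p} {c : ℝ} (hc : 0 ≤ c) (e : α ≃ β)
    (h : ∀ k, ‖x k‖ ≤ c * ‖y (e k)‖) : ‖x‖ ≤ c * ‖y‖ :=
  lp.norm_le_of_forall_sum_le hp (mul_nonneg hc (lp.norm_nonneg' y))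
    (sum_norm_rpow_le_of_norm_le_comp hp hc e h)

end Reindex

theorem norm_apply_le_toReal_iSup {ι : Type*} {B : ι → H →L[ℂ] H} (hB : ⨆ k, ‖B k‖ₑ ≠ ∞) (k : ι)
    (v : H) : ‖B k v‖ ≤ (⨆ k, ‖B k‖ₑ).toReal * ‖v‖ := by
  refine (B k).le_of_opNorm_le ?_ v
  rw [← toReal_enorm]
  exact ENNReal.toReal_mono hB (le_iSup (fun k => ‖B k‖ₑ) k)

/-- The operator `(x_k)_k ↦ (B_k x_{k-m})_k`, whose matrix lives on the `m`-th side diagonal. -/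
def weightedShift (B : (Fin d → ℤ) → H →L[ℂ] H) (hB : ⨆ k, ‖B k‖ₑ ≠ ∞) (m : Fin d → ℤ) :
    L2 d H →L[ℂ] L2 d H :=
  LinearMap.mkContinuous
    { toFun := fun x => ⟨fun k => B k (x (k - m)), memℓp_of_norm_le_comp (by simp)
        ENNReal.toReal_nonneg (Equiv.subRight m) fun k => norm_apply_le_toReal_iSup hB k _⟩
      map_add' := fun _ _ => lp.ext (funext fun k => map_add (B k) _ _)
      map_smul' := fun _ _ => lp.ext (funext fun k => map_smul (B k) _ _) }
    (⨆ k, ‖B k‖ₑ).toReal fun x => norm_le_of_norm_le_comp (by simp) ENNReal.toReal_nonneg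
      (Equiv.subRight m) fun k => norm_apply_le_toReal_iSup hB k _

theorem weightedShift_apply (B : (Fin d → ℤ) → H →L[ℂ] H) (hB : ⨆ k, ‖B k‖ₑ ≠ ∞)
    (m : Fin d → ℤ) (x : L2 d H) (k : Fin d → ℤ) : weightedShift B hB m x k = B k (x (k - m)) := rfl

theorem enorm_weightedShift_le (B : (Fin d → ℤ) → H →L[ℂ] H) (hB : ⨆ k, ‖B k‖ₑ ≠ ∞)
    (m : Fin d → ℤ) : ‖weightedShift B hB m‖ₑ ≤ ⨆ k, ‖B k‖ₑ := by
  rw [← ofReal_norm]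
  exact ENNReal.ofReal_le_of_le_toReal (LinearMap.mkContinuous_norm_le _ ENNReal.toReal_nonneg _)

/-- The operator given by the `m`-th side diagonal of a matrix. -/
def diagOp (A : OpMatrix d H) (hA : (diagSup A).mass ≠ ∞) (m : Fin d → ℤ) :
    L2 d H →L[ℂ] L2 d H :=
  weightedShift (fun k => A k (k - m)) (diagSup_ne_top hA m) m

theorem diagOp_apply (A : OpMatrix d H) (hA : (diagSup A).mass ≠ ∞) (m k : Fin d → ℤ)
    (x : L2 d H) : diagOp A hA m x k = A k (k - m) (x (k - m)) := rfl

theorem enorm_diagOp_le (A : OpMatrix d H) (hA : (diagSup A).mass ≠ ∞) (m : Fin d → ℤ) :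
    ‖diagOp A hA m‖ₑ ≤ diagSup A m :=
  enorm_weightedShift_le _ _ _

variable [CompleteSpace H]

theorem summable_diagOp (A : OpMatrix d H) (hA : (diagSup A).mass ≠ ∞) :
    Summable (diagOp A hA) :=
  Summable.of_enorm (ne_top_of_le_ne_top hA (ENNReal.tsum_le_tsum (enorm_diagOp_le A hA)))

/-- The operator defined by a matrix with summable diagonals. -/
def matrixOp (A : OpMatrix d H) (hA : (diagSup A).mass ≠ ∞) : L2 d H →L[ℂ] L2 d H :=
  ∑' m, diagOp A hA m

theorem hasSum_matrixOp_apply (A : OpMatrix d H) (hA : (diagSup A).mass ≠ ∞) (x : L2 d H)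
    (k : Fin d → ℤ) : HasSum (fun l => A k l (x l)) (matrixOp A hA x k) := by
  rw [← (Equiv.subLeft k).hasSum_iff]
  exact ((summable_diagOp A hA).hasSum.mapL (ContinuousLinearMap.apply ℂ (L2 d H) x)).mapL (coord k)

theorem canonicalMatrix_matrixOp (A : OpMatrix d H) (hA : (diagSup A).mass ≠ ∞) :
    canonicalMatrix (matrixOp A hA) = A :=
  (canonicalMatrix_eq_iff _ _).2 (hasSum_matrixOp_apply A hA)

theorem hasSum_diagOp (T : L2 d H →L[ℂ] L2 d H) (hT : (decay T).mass ≠ ∞) :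
    HasSum (diagOp (canonicalMatrix T) hT) T := by
  nth_rw 2 [← canonicalMatrix_injective (canonicalMatrix_matrixOp _ hT)]
  exact (summable_diagOp _ hT).hasSum

theorem enorm_le_mass_decay (T : L2 d H →L[ℂ] L2 d H) : ‖T‖ₑ ≤ (decay T).mass := by
  by_cases hT : (decay T).mass = ∞
  · exact le_top.trans_eq hT.symm
  calc ‖T‖ₑ = ‖∑' m, diagOp (canonicalMatrix T) hT m‖ₑ := by rw [(hasSum_diagOp T hT).tsum_eq]
    _ ≤ ∑' m, ‖diagOp (canonicalMatrix T) hT m‖ₑ := enorm_tsum_le_tsum_enorm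
    _ ≤ (decay T).mass := ENNReal.tsum_le_tsum fun m => enorm_diagOp_le _ hT m

end Operators

/-! ### Tent functions on the lattice -/

section Tent

variable {E : Type*} [SeminormedAddCommGroup E]

/-- The tent function at scale `r`, equal to `1` on the ball of radius `r` and vanishing outside
the ball of radius `2 * r`. -/
def tent (r : ℝ) (x : E) : ℝ := max 0 (min 1 (2 - ‖x‖ / r))

/-- The bound `min 1 (‖x‖ / r)` for the increments of step `x` of the tent function at scale `r`. -/
def damping (r : ℝ) (x : E) : ℝ := min 1 (‖x‖ / r)

theorem tent_nonneg (r : ℝ) (x : E) : 0 ≤ tent r x := le_max_left _ _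

theorem tent_le_one (r : ℝ) (x : E) : tent r x ≤ 1 := max_le zero_le_one (min_le_left _ _)

theorem tent_eq_one {r : ℝ} (hr : 0 < r) {x : E} (hx : ‖x‖ ≤ r) : tent r x = 1 := by
  have hx1 : ‖x‖ / r ≤ 1 := (div_le_one hr).2 hx
  rw [tent, min_eq_left (by linarith), max_eq_right zero_le_one]

theorem norm_le_of_tent_ne_zero {r : ℝ} (hr : 0 < r) {x : E} (hx : tent r x ≠ 0) :
    ‖x‖ ≤ 2 * r := by
  by_contra! hlt
  have hlt' : 2 < ‖x‖ / r := (lt_div_iff₀ hr).2 hlt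
  exact hx (max_eq_left ((min_le_right _ _).trans (by linarith)))

theorem damping_nonneg {r : ℝ} (hr : 0 ≤ r) (x : E) : 0 ≤ damping r x :=
  le_min zero_le_one (by positivity)

theorem damping_le_one (r : ℝ) (x : E) : damping r x ≤ 1 := min_le_left _ _

theorem tendsto_damping (x : E) : Tendsto (fun n : ℕ => damping n x) atTop (𝓝 0) := by
  simpa [damping] using
    tendsto_const_nhds (x := (1 : ℝ)).min (tendsto_const_div_atTop_nhds_zero_nat ‖x‖)

theorem abs_tent_sub_le {r : ℝ} (hr : 0 ≤ r) (x y : E) :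
    |tent r x - tent r y| ≤ damping r (x - y) := by
  refine le_min ?_ ?_
  · rw [abs_le]
    constructor <;> linarith [tent_nonneg r x, tent_nonneg r y, tent_le_one r x, tent_le_one r y]
  · calc |tent r x - tent r y|
        ≤ |min 1 (2 - ‖x‖ / r) - min 1 (2 - ‖y‖ / r)| := by
          simpa only [tent, max_comm (0 : ℝ)] using abs_max_sub_max_le_abs _ _ 0
      _ ≤ |(2 - ‖x‖ / r) - (2 - ‖y‖ / r)| := by
          simpa using abs_min_sub_min_le_max 1 (2 - ‖x‖ / r) 1 (2 - ‖y‖ / r)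
      _ = |‖y‖ - ‖x‖| / r := by
          rw [sub_sub_sub_cancel_left, ← sub_div, abs_div, abs_of_nonneg hr]
      _ ≤ ‖x - y‖ / r := by
          rw [norm_sub_rev]
          gcongr
          exact abs_norm_sub_norm_le y x

end Tent

section Lattice

variable {d : ℕ}

/-- The lattice points in the closed ball of radius `R` for the supremum norm. -/
def latticeBall (d : ℕ) (R : ℝ) : Finset (Fin d → ℤ) :=
  (isCompact_closedBall (0 : Fin d → ℤ) R).finite_of_discrete.toFinset

theorem mem_latticeBall {R : ℝ} {x : Fin d → ℤ} : x ∈ latticeBall d R ↔ ‖x‖ ≤ R := by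
  simp [latticeBall]

theorem norm_le_of_norm_nsmul_le {N : ℕ} (hN : 0 < N) {x : Fin d → ℤ} {R : ℝ}
    (h : ‖N • x‖ ≤ R * N) : ‖x‖ ≤ R := by
  have hN' : (0 : ℝ) < N := Nat.cast_pos.2 hN
  have hR : 0 ≤ R := nonneg_of_mul_nonneg_left ((norm_nonneg _).trans h) hN'
  refine (pi_norm_le_iff_of_nonneg hR).2 fun i => le_of_mul_le_mul_right ?_ hN'
  simpa [mul_comm] using (norm_le_pi_norm (N • x) i).trans h

/-- The index of the cube of side length `N` containing a given lattice point. -/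
def cubeIndex (N : ℕ) (k : Fin d → ℤ) : Fin d → ℤ := fun i => k i / N

theorem norm_sub_nsmul_cubeIndex_le {N : ℕ} (hN : 0 < N) (k : Fin d → ℤ) :
    ‖k - N • cubeIndex N k‖ ≤ N := by
  refine (pi_norm_le_iff_of_nonneg N.cast_nonneg).2 fun i => ?_
  have coord_eq : (k - N • cubeIndex N k) i = k i % N := by
    rw [Pi.sub_apply, Pi.smul_apply, nsmul_eq_mul, Int.emod_def]
    rfl
  have hN' : (0 : ℤ) < N := by exact_mod_cast hN
  rw [coord_eq, Int.norm_eq_abs, abs_of_nonneg (by exact_mod_cast Int.emod_nonneg _ hN'.ne')]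
  exact_mod_cast (Int.emod_lt_of_pos (k i) hN').le

/-- A set of indices `i`, of cardinality bounded in terms of `d` only, such that the tents around
the points `N • (j - i)` control the increments of step `m` of the tent around `N • j`. -/
def tentShifts (N : ℕ) (m : Fin d → ℤ) : Finset (Fin d → ℤ) :=
  latticeBall d 4 ∪ (latticeBall d 4).image (cubeIndex N m - ·)

theorem card_tentShifts_le (N : ℕ) (m : Fin d → ℤ) :
    (tentShifts N m).card ≤ 2 * (latticeBall d 4).card := by
  rw [two_mul]
  exact (Finset.card_union_le _ _).trans (add_le_add_right Finset.card_image_le _)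

theorem sub_cubeIndex_mem_tentShifts {N : ℕ} (hN : 0 < N) {j l m : Fin d → ℤ}
    (h : tent N (l - N • j) ≠ 0 ∨ tent N (l + m - N • j) ≠ 0) :
    j - cubeIndex N l ∈ tentShifts N m := by
  have hN' : (0 : ℝ) < N := Nat.cast_pos.2 hN
  have l_near := norm_sub_nsmul_cubeIndex_le hN l
  rw [tentShifts, Finset.mem_union, Finset.mem_image]
  rcases h with h | h
  · refine .inl (mem_latticeBall.2 (norm_le_of_norm_nsmul_le hN ?_))
    rw [show N • (j - cubeIndex N l) = (l - N • cubeIndex N l) - (l - N • j) by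
      rw [smul_sub]; abel]
    linarith [norm_sub_le (l - N • cubeIndex N l) (l - N • j), norm_le_of_tent_ne_zero hN' h]
  · refine .inr ⟨cubeIndex N m - (j - cubeIndex N l),
      mem_latticeBall.2 (norm_le_of_norm_nsmul_le hN ?_), sub_sub_cancel _ _⟩
    rw [show N • (cubeIndex N m - (j - cubeIndex N l)) = (l + m - N • j) -
        ((l - N • cubeIndex N l) + (m - N • cubeIndex N m)) by
      simp only [smul_sub]; abel]
    linarith [norm_sub_le (l + m - N • j) ((l - N • cubeIndex N l) + (m - N • cubeIndex N m)),
      norm_add_le (l - N • cubeIndex N l) (m - N • cubeIndex N m),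
      norm_sub_nsmul_cubeIndex_le hN m, norm_le_of_tent_ne_zero hN' h]

theorem abs_tent_add_sub_le {N : ℕ} (hN : 0 < N) (j l m : Fin d → ℤ) :
    |tent N (l + m - N • j) - tent N (l - N • j)| ≤
      damping N m * ∑ i ∈ tentShifts N m, tent N (l - N • (j - i)) := by
  by_cases h : tent N (l - N • j) ≠ 0 ∨ tent N (l + m - N • j) ≠ 0
  · have one_le_sum : 1 ≤ ∑ i ∈ tentShifts N m, tent N (l - N • (j - i)) :=
      calc (1 : ℝ) = tent N (l - N • (j - (j - cubeIndex N l))) := by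
            rw [sub_sub_cancel,
              tent_eq_one (Nat.cast_pos.2 hN) (norm_sub_nsmul_cubeIndex_le hN l)]
        _ ≤ _ := Finset.single_le_sum (f := fun i => tent N (l - N • (j - i)))
            (fun i _ => tent_nonneg _ _) (sub_cubeIndex_mem_tentShifts hN h)
    calc |tent N (l + m - N • j) - tent N (l - N • j)|
        ≤ damping N ((l + m - N • j) - (l - N • j)) := abs_tent_sub_le N.cast_nonneg _ _
      _ = damping N m * 1 := by rw [sub_sub_sub_cancel_right, add_sub_cancel_left, mul_one]
      _ ≤ _ := mul_le_mul_of_nonneg_left one_le_sum (damping_nonneg N.cast_nonneg m)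
  · push Not at h
    rw [h.1, h.2, sub_self, abs_zero]
    exact mul_nonneg (damping_nonneg N.cast_nonneg m) (Finset.sum_nonneg fun i _ => tent_nonneg _ _)

end Lattice

/-! ### Localization of operators with summable side diagonals -/

theorem tsum_indicator_one_mul {ι : Type*} (s : Finset ι) (f : ι → ℝ≥0∞) :
    ∑' i, (s : Set ι).indicator 1 i * f i = ∑ i ∈ s, f i := by
  classical
  rw [tsum_eq_sum (s := s) fun i hi => by simp [hi]]
  exact Finset.sum_congr rfl fun i hi => by simp [hi]

theorem tsum_indicator_one {ι : Type*} (s : Finset ι) :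
    ∑' i, (s : Set ι).indicator (1 : ι → ℝ≥0∞) i = s.card := by
  simpa using tsum_indicator_one_mul s 1

section Localization

variable {d : ℕ} {H : Type*} [NormedAddCommGroup H] [InnerProductSpace ℂ H]

theorem iSup_enorm_tent_smul_one_le (N : ℕ) (j : Fin d → ℤ) :
    ⨆ k, ‖(tent N (k - N • j) : ℂ) • (1 : H →L[ℂ] H)‖ₑ ≤ 1 := by
  refine iSup_le fun k => ContinuousLinearMap.opENorm_le_bound _ fun v => ?_
  have enorm_tent_le : ‖(tent N (k - N • j) : ℂ)‖ₑ ≤ 1 := by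
    rw [← ofReal_norm, Complex.norm_real, Real.norm_of_nonneg (tent_nonneg _ _)]
    exact ENNReal.ofReal_le_one.2 (tent_le_one _ _)
  rw [smul_apply, enorm_smul]
  exact mul_le_mul_left enorm_tent_le _

/-- Multiplication by the tent function around the point `N • j` at scale `N`. -/
def tentOp (N : ℕ) (j : Fin d → ℤ) : L2 d H →L[ℂ] L2 d H :=
  weightedShift (fun k => (tent N (k - N • j) : ℂ) • 1)
    (ne_top_of_le_ne_top ENNReal.one_ne_top (iSup_enorm_tent_smul_one_le N j)) 0

theorem tentOp_apply (N : ℕ) (j : Fin d → ℤ) (x : L2 d H) (k : Fin d → ℤ) :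
    tentOp N j x k = (tent N (k - N • j) : ℂ) • x k := by
  simp [tentOp, weightedShift_apply]

theorem enorm_tentOp_apply_le (N : ℕ) (j : Fin d → ℤ) (x : L2 d H) : ‖tentOp N j x‖ₑ ≤ ‖x‖ₑ :=
  (ContinuousLinearMap.le_opENorm _ x).trans <| mul_le_of_le_one_left zero_le <|
    (enorm_weightedShift_le _ _ _).trans (iSup_enorm_tent_smul_one_le N j)

/-- The norms of a vector localized around the points of the lattice `N • ℤ^d`. -/
def localNorm (N : ℕ) (x : L2 d H) : ConvSeq (Fin d → ℤ) := ⟨fun j => ‖tentOp N j x‖ₑ⟩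

theorem localNorm_apply (N : ℕ) (x : L2 d H) (j : Fin d → ℤ) :
    localNorm N x j = ‖tentOp N j x‖ₑ := rfl

theorem enorm_apply_le_localNorm {N : ℕ} (hN : 0 < N) (x : L2 d H) (k : Fin d → ℤ) :
    ‖x k‖ₑ ≤ localNorm N x (cubeIndex N k) := by
  have tentOp_eq : tentOp N (cubeIndex N k) x k = x k := by
    rw [tentOp_apply, tent_eq_one (Nat.cast_pos.2 hN) (norm_sub_nsmul_cubeIndex_le hN k),
      Complex.ofReal_one, one_smul]
  rw [← tentOp_eq, localNorm_apply, enorm_le_iff_norm_le]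
  exact lp.norm_apply_le_norm two_ne_zero _ k

theorem tentOp_single (N : ℕ) (j m : Fin d → ℤ) (v : H) :
    tentOp N j (lp.single 2 m v : L2 d H) = (tent N (m - N • j) : ℂ) • lp.single 2 m v := by
  refine lp.ext (funext fun k => ?_)
  rw [tentOp_apply, lp.coeFn_smul, Pi.smul_apply]
  by_cases hk : k = m
  · rw [hk]
  · rw [lp.single_apply_ne _ _ _ hk, smul_zero, smul_zero]

theorem localNorm_single_apply (N : ℕ) (m : Fin d → ℤ) (v : H) (j : Fin d → ℤ) :
    localNorm N (lp.single 2 m v : L2 d H) j = ‖tent N (m - N • j)‖ₑ * ‖v‖ₑ := by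
  rw [localNorm_apply, tentOp_single, enorm_smul]
  congr 1
  · simp [← ofReal_norm]
  · rw [← ofReal_norm, lp.norm_single (by simp), ofReal_norm]

theorem enorm_diagOp_commutator_le (A : OpMatrix d H) (hA : (diagSup A).mass ≠ ∞) {N : ℕ}
    (hN : 0 < N) (j m : Fin d → ℤ) (x : L2 d H) :
    ‖diagOp A hA m (tentOp N j x) - tentOp N j (diagOp A hA m x)‖ₑ ≤
      diagSup A m * ENNReal.ofReal (damping N m) *
        ∑ i ∈ tentShifts N m, localNorm N x (j - i) := by
  set y : L2 d H := ∑ i ∈ tentShifts N m, tentOp N (j - i) x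
  have y_apply (k) : y k = ((∑ i ∈ tentShifts N m, tent N (k - N • (j - i)) : ℝ) : ℂ) • x k := by
    simp only [y, lp.coeFn_sum, Finset.sum_apply, tentOp_apply, Complex.ofReal_sum,
      Finset.sum_smul]
  have commutator_apply (k) :
      (diagOp A hA m (tentOp N j x) - tentOp N j (diagOp A hA m x)) k =
        ((tent N (k - m - N • j) - tent N (k - N • j) : ℝ) : ℂ) • A k (k - m) (x (k - m)) := by
    rw [lp.coeFn_sub, Pi.sub_apply, diagOp_apply, tentOp_apply, tentOp_apply, diagOp_apply,
      map_smul, ← sub_smul, Complex.ofReal_sub]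
  have damping_nn : 0 ≤ damping (N : ℝ) m := damping_nonneg N.cast_nonneg m
  have norm_le : ‖diagOp A hA m (tentOp N j x) - tentOp N j (diagOp A hA m x)‖ ≤
      (diagSup A m).toReal * damping N m * ‖y‖ := by
    refine norm_le_of_norm_le_comp (by simp) (by positivity) (Equiv.subRight m) fun k => ?_
    have tent_le := abs_tent_add_sub_le hN j (k - m) m
    rw [sub_add_cancel, abs_sub_comm] at tent_le
    rw [commutator_apply, Equiv.subRight_apply, y_apply, norm_smul, norm_smul, Complex.norm_real,
      Complex.norm_real, Real.norm_eq_abs,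
      Real.norm_of_nonneg (Finset.sum_nonneg fun i _ => tent_nonneg _ _)]
    calc _ ≤ (damping N m * ∑ i ∈ tentShifts N m, tent N (k - m - N • (j - i))) *
          ((diagSup A m).toReal * ‖x (k - m)‖) :=
        mul_le_mul tent_le (norm_apply_le_toReal_iSup (diagSup_ne_top hA m) k _) (norm_nonneg _)
          ((abs_nonneg _).trans tent_le)
      _ = _ := by ring
  calc _ ≤ diagSup A m * ENNReal.ofReal (damping N m) * ‖y‖ₑ := by
        rw [← ofReal_norm, ← ofReal_norm, ← ENNReal.ofReal_toReal (diagSup_ne_top hA m),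
          ← ENNReal.ofReal_mul ENNReal.toReal_nonneg, ← ENNReal.ofReal_mul (by positivity)]
        exact ENNReal.ofReal_le_ofReal norm_le
    _ ≤ _ := mul_le_mul_right (enorm_sum_le _ _) _

/-- The sequence by which the commutators of an operator with decay `a` and the tent functions at
scale `N` act, by convolution, on local norms. -/
def commutatorSeq (a : ConvSeq (Fin d → ℤ)) (N : ℕ) : ConvSeq (Fin d → ℤ) :=
  ⟨fun i => ∑' m, a m * ENNReal.ofReal (damping N m) *
    (tentShifts N m : Set (Fin d → ℤ)).indicator 1 i⟩

theorem commutatorSeq_mul_apply (a v : ConvSeq (Fin d → ℤ)) (N : ℕ) (j : Fin d → ℤ) :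
    (commutatorSeq a N * v) j =
      ∑' m, a m * ENNReal.ofReal (damping N m) * ∑ i ∈ tentShifts N m, v (j - i) := by
  simp only [ConvSeq.mul_apply, commutatorSeq, ← ENNReal.tsum_mul_right]
  rw [ENNReal.tsum_comm]
  refine tsum_congr fun m => ?_
  simp only [mul_assoc, ENNReal.tsum_mul_left, tsum_indicator_one_mul]

theorem mass_commutatorSeq_le (a : ConvSeq (Fin d → ℤ)) (N : ℕ) :
    (commutatorSeq a N).mass ≤
      (2 * (latticeBall d 4).card : ℕ) * ∑' m, a m * ENNReal.ofReal (damping N m) := by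
  simp only [ConvSeq.mass, commutatorSeq]
  rw [ENNReal.tsum_comm, mul_comm, ← ENNReal.tsum_mul_right]
  refine ENNReal.tsum_le_tsum fun m => ?_
  rw [ENNReal.tsum_mul_left, tsum_indicator_one]
  gcongr
  exact card_tentShifts_le N m

theorem tendsto_mass_commutatorSeq {a : ConvSeq (Fin d → ℤ)} (ha : a.mass ≠ ∞) :
    Tendsto (fun N => (commutatorSeq a N).mass) atTop (𝓝 0) := by
  have damping_sum : Tendsto (fun N : ℕ => ∑' m, a m * ENNReal.ofReal (damping N m)) atTop (𝓝 0) :=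
    tendsto_tsum_mul_zero ha (fun N m => ENNReal.ofReal_le_one.2 (damping_le_one _ _)) fun m => by
      simpa using ENNReal.tendsto_ofReal (tendsto_damping m)
  have bound := ENNReal.Tendsto.const_mul damping_sum
    (.inr (ENNReal.natCast_ne_top (2 * (latticeBall d 4).card)))
  rw [mul_zero] at bound
  exact tendsto_of_tendsto_of_tendsto_of_le_of_le tendsto_const_nhds bound (fun _ => zero_le)
    (mass_commutatorSeq_le a)

variable [CompleteSpace H]

theorem enorm_commutator_tentOp_le (T : L2 d H →L[ℂ] L2 d H) (hT : (decay T).mass ≠ ∞) {N : ℕ}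
    (hN : 0 < N) (x : L2 d H) (j : Fin d → ℤ) :
    ‖T (tentOp N j x) - tentOp N j (T x)‖ₑ ≤ (commutatorSeq (decay T) N * localNorm N x) j := by
  have hasSum_commutator : HasSum (fun m => diagOp (canonicalMatrix T) hT m (tentOp N j x) -
      tentOp N j (diagOp (canonicalMatrix T) hT m x)) (T (tentOp N j x) - tentOp N j (T x)) :=
    ((hasSum_diagOp T hT).mapL (ContinuousLinearMap.apply ℂ (L2 d H) (tentOp N j x))).sub
      (((hasSum_diagOp T hT).mapL (ContinuousLinearMap.apply ℂ (L2 d H) x)).mapL (tentOp N j))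
  rw [← hasSum_commutator.tsum_eq, commutatorSeq_mul_apply]
  exact enorm_tsum_le_tsum_enorm.trans
    (ENNReal.tsum_le_tsum fun m => enorm_diagOp_commutator_le _ hT hN j m x)

theorem localNorm_le_add_commutatorSeq_mul {S T : L2 d H →L[ℂ] L2 d H} (hST : S * T = 1)
    (hT : (decay T).mass ≠ ∞) {N : ℕ} (hN : 0 < N) (x : L2 d H) :
    localNorm N x ≤ ‖S‖ₑ • localNorm N (T x) +
      (‖S‖ₑ • commutatorSeq (decay T) N) * localNorm N x := by
  intro j
  rw [ConvSeq.smul_mul, ConvSeq.add_apply, ConvSeq.smul_apply, ConvSeq.smul_apply, ← mul_add]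
  calc ‖tentOp N j x‖ₑ = ‖S (T (tentOp N j x))‖ₑ := by
        rw [← mul_apply_eq_comp, hST, one_apply_eq_self]
    _ ≤ ‖S‖ₑ * ‖T (tentOp N j x)‖ₑ := S.le_opENorm _
    _ = ‖S‖ₑ * ‖tentOp N j (T x) + (T (tentOp N j x) - tentOp N j (T x))‖ₑ := by
        rw [add_sub_cancel]
    _ ≤ _ := mul_le_mul_right ((enorm_add_le _ _).trans
        (add_le_add_right (enorm_commutator_tentOp_le T hT hN x j) _)) _

theorem enorm_tent_le_indicator {N : ℕ} (hN : 0 < N) (i k l : Fin d → ℤ) :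
    ‖tent N (k - l - N • (cubeIndex N k - i))‖ₑ ≤
      (latticeBall d (3 * N) : Set (Fin d → ℤ)).indicator 1 (l - N • i) := by
  by_cases h : tent N (k - l - N • (cubeIndex N k - i)) = 0
  · rw [h, enorm_zero]
    exact zero_le
  · have mem_ball : l - N • i ∈ latticeBall d (3 * N) := by
      rw [mem_latticeBall, show l - N • i =
        (k - N • cubeIndex N k) - (k - l - N • (cubeIndex N k - i)) by rw [smul_sub]; abel]
      linarith [norm_sub_le (k - N • cubeIndex N k) (k - l - N • (cubeIndex N k - i)),
        norm_sub_nsmul_cubeIndex_le hN k, norm_le_of_tent_ne_zero (Nat.cast_pos.2 hN) h]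
    rw [Set.indicator_of_mem (Finset.mem_coe.2 mem_ball), Pi.one_apply,
      Real.enorm_of_nonneg (tent_nonneg _ _)]
    exact ENNReal.ofReal_le_one.2 (tent_le_one _ _)

theorem decay_inverse_apply_le {S T : L2 d H →L[ℂ] L2 d H} (hST : S * T = 1) (hTS : T * S = 1)
    (hT : (decay T).mass ≠ ∞) {N : ℕ} (hN : 0 < N)
    (hlt : (‖S‖ₑ • commutatorSeq (decay T) N).mass < 1) (l : Fin d → ℤ) :
    decay S l ≤ ∑' i, (‖S‖ₑ • commutatorSeq (decay T) N).neumann i *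
      (‖S‖ₑ * (latticeBall d (3 * N) : Set (Fin d → ℤ)).indicator 1 (l - N • i)) := by
  set κ := ‖S‖ₑ • commutatorSeq (decay T) N
  refine iSup_le fun k => ContinuousLinearMap.opENorm_le_bound _ fun v => ?_
  set e : L2 d H := lp.single 2 (k - l) v
  have T_apply : T (S e) = e := by rw [← mul_apply_eq_comp, hTS, one_apply_eq_self]
  have localNorm_le : localNorm N (S e) ≤ κ.neumann * (‖S‖ₑ • localNorm N e) := by
    refine ConvSeq.le_neumann_mul enorm_ne_top (fun j => enorm_tentOp_apply_le N j (S e)) hlt ?_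
    simpa only [T_apply] using localNorm_le_add_commutatorSeq_mul hST hT hN (S e)
  calc ‖S e k‖ₑ ≤ (κ.neumann * (‖S‖ₑ • localNorm N e)) (cubeIndex N k) :=
        (enorm_apply_le_localNorm hN (S e) k).trans (localNorm_le _)
    _ = (∑' i, κ.neumann i * (‖S‖ₑ * ‖tent N (k - l - N • (cubeIndex N k - i))‖ₑ)) * ‖v‖ₑ := by
        simp only [e, ConvSeq.mul_apply, ConvSeq.smul_apply, localNorm_single_apply,
          ← ENNReal.tsum_mul_right, mul_assoc]
    _ ≤ _ := mul_le_mul_left (ENNReal.tsum_le_tsum fun i =>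
        mul_le_mul_right (mul_le_mul_right (enorm_tent_le_indicator hN i k l) _) _) _

/-- Wiener's lemma for operators with summable side diagonals. -/
theorem mass_decay_inverse_lt_top {S T : L2 d H →L[ℂ] L2 d H} (hST : S * T = 1)
    (hTS : T * S = 1) (hT : (decay T).mass ≠ ∞) : (decay S).mass < ∞ := by
  have tendsto_mass :
      Tendsto (fun N => (‖S‖ₑ • commutatorSeq (decay T) N).mass) atTop (𝓝 0) := by
    simpa [ConvSeq.mass_smul] using
      ENNReal.Tendsto.const_mul (tendsto_mass_commutatorSeq hT) (.inr (enorm_ne_top (x := S)))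
  obtain ⟨N, hlt, hN⟩ :=
    ((tendsto_mass.eventually (gt_mem_nhds zero_lt_one)).and (eventually_gt_atTop 0)).exists
  have sum_indicator (i : Fin d → ℤ) :
      ∑' l, (latticeBall d (3 * N) : Set (Fin d → ℤ)).indicator (1 : (Fin d → ℤ) → ℝ≥0∞)
        (l - N • i) = (latticeBall d (3 * N)).card :=
    ((Equiv.subRight (N • i)).tsum_eq _).trans (tsum_indicator_one _)
  calc (decay S).mass
      ≤ ∑' l, ∑' i, (‖S‖ₑ • commutatorSeq (decay T) N).neumann i *
          (‖S‖ₑ * (latticeBall d (3 * N) : Set (Fin d → ℤ)).indicator 1 (l - N • i)) :=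
        ENNReal.tsum_le_tsum (decay_inverse_apply_le hST hTS hT hN hlt)
    _ = (‖S‖ₑ • commutatorSeq (decay T) N).neumann.mass *
          (‖S‖ₑ * (latticeBall d (3 * N)).card) := by
        rw [ENNReal.tsum_comm]
        simp only [ENNReal.tsum_mul_left, sum_indicator, ENNReal.tsum_mul_right, ConvSeq.mass]
    _ < ∞ := by
        rw [ConvSeq.mass_neumann]
        exact ENNReal.mul_lt_top (ENNReal.inv_lt_top.2 (tsub_pos_of_lt hlt))
          (ENNReal.mul_lt_top enorm_lt_top (ENNReal.natCast_lt_top _))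

end Localization

/-! ### The norm of the class -/

section ClassNorm

variable {d : ℕ} {H : Type*} [NormedAddCommGroup H] [InnerProductSpace ℂ H] {p : ℝ}
  {ν : (Fin d → ℤ) → ℝ≥0}

theorem bgsSum_eq_tsum_diagSup (hp : 0 < p) (A : OpMatrix d H) :
    bgsSum p ν A = ∑' l, (diagSup A l * ν l) ^ p := by
  simp only [ENNReal.mul_rpow_of_nonneg _ _ hp.le, diagSup_apply, bgsSum]

theorem mem_bgsClass_iff (hp : 0 < p) (A : OpMatrix d H) :
    A ∈ bgsClass d H p ν ↔ weightedNorm p ν (diagSup A) < ∞ := by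
  rw [weightedNorm_lt_top_iff hp, ← bgsSum_eq_tsum_diagSup hp]
  rfl

theorem bgsNorm_eq_toReal_weightedNorm (hp : 0 < p) (A : OpMatrix d H) :
    bgsNorm p ν A = (weightedNorm p ν (diagSup A)).toReal := by
  rw [bgsNorm, bgsSum_eq_tsum_diagSup hp]
  split_ifs with hp1
  · rw [weightedNorm_of_le_one hp hp1]
  · rw [weightedNorm_of_one_le (not_le.1 hp1).le, ENNReal.toReal_rpow]

/-- The norm (or `p`-norm) of an operator in the class, as an extended nonnegative real number
which is infinite outside the class. -/
def classNorm (p : ℝ) (ν : (Fin d → ℤ) → ℝ≥0) (T : L2 d H →L[ℂ] L2 d H) : ℝ≥0∞ :=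
  weightedNorm p ν (decay T)

theorem classNorm_add_le (hp : 0 < p) (S T : L2 d H →L[ℂ] L2 d H) :
    classNorm p ν (S + T) ≤ classNorm p ν S + classNorm p ν T :=
  (weightedNorm_mono hp (decay_add_le S T)).trans (weightedNorm_add_le hp _ _)

theorem classNorm_smul (hp : 0 < p) (c : ℂ) (T : L2 d H →L[ℂ] L2 d H) :
    classNorm p ν (c • T) = ‖c‖ₑ ^ min p 1 * classNorm p ν T := by
  rw [classNorm, decay_smul, weightedNorm_smul hp, classNorm]

theorem classNorm_one_lt_top (hp : 0 < p) : classNorm p ν (1 : L2 d H →L[ℂ] L2 d H) < ∞ := by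
  have one_eq : (1 : ConvSeq (Fin d → ℤ)) =
      (1 : ConvSeq _).restrict (({0} : Finset (Fin d → ℤ)) : Set (Fin d → ℤ)) := by
    ext l
    by_cases hl : l = 0 <;> simp [ConvSeq.restrict_apply, ConvSeq.one_apply, hl]
  refine (weightedNorm_mono hp (decay_one_le.trans_eq one_eq)).trans_lt
    (weightedNorm_restrict_lt_top hp (fun l => ?_) _)
  rw [ConvSeq.one_apply]
  split_ifs <;> simp

theorem classNorm_mul_le (hp : 0 < p) (hν : IsAdmissible ν) (hpν : 1 < p → IsPAlgebraWeight p ν)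
    (S T : L2 d H →L[ℂ] L2 d H) : classNorm p ν (S * T) ≤ classNorm p ν S * classNorm p ν T :=
  (weightedNorm_mono hp (decay_mul_le S T)).trans
    (weightedNorm_mul_le hp hν.ne_zero hν.submul hpν _ _)

theorem classNorm_star [CompleteSpace H] (hν : IsAdmissible ν) (T : L2 d H →L[ℂ] L2 d H) :
    classNorm p ν (star T) = classNorm p ν T := by
  rw [classNorm, decay_star, weightedNorm_reflect hν.symm, classNorm]

theorem classNorm_eq_zero_iff (hp : 0 < p) (hν : IsAdmissible ν) {T : L2 d H →L[ℂ] L2 d H} :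
    classNorm p ν T = 0 ↔ T = 0 :=
  (weightedNorm_eq_zero_iff hp hν.ne_zero).trans decay_eq_zero_iff

theorem classNorm_sum_le (hp : 0 < p) {ι : Type*} (s : Finset ι) (T : ι → L2 d H →L[ℂ] L2 d H) :
    classNorm p ν (∑ i ∈ s, T i) ≤ ∑ i ∈ s, classNorm p ν (T i) := by
  refine Finset.le_sum_of_subadditive _ ?_ (classNorm_add_le hp) s T
  rw [← zero_smul ℂ (0 : L2 d H →L[ℂ] L2 d H), classNorm_smul hp, enorm_zero,
    ENNReal.zero_rpow_of_pos (min_one_pos hp), zero_mul]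

theorem lowerSemicontinuous_decay_apply (l : Fin d → ℤ) :
    LowerSemicontinuous fun T : L2 d H →L[ℂ] L2 d H => decay T l :=
  lowerSemicontinuous_iSup fun k =>
    (continuous_enorm.comp (continuous_canonicalMatrix_apply k (k - l))).lowerSemicontinuous

theorem lowerSemicontinuous_classNorm (hp : 0 < p) :
    LowerSemicontinuous (classNorm p ν : (L2 d H →L[ℂ] L2 d H) → ℝ≥0∞) := by
  have summand_continuous (l : Fin d → ℤ) : Continuous fun t : ℝ≥0∞ => (t * ν l) ^ p :=
    ENNReal.continuous_rpow_const.comp (ENNReal.continuous_mul_const ENNReal.coe_ne_top)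
  have sum_lsc : LowerSemicontinuous fun T : L2 d H →L[ℂ] L2 d H =>
      ∑' l, (decay T l * ν l) ^ p :=
    lowerSemicontinuous_tsum fun l => (summand_continuous l).comp_lowerSemicontinuous
      (lowerSemicontinuous_decay_apply l) fun _ _ hst =>
        ENNReal.rpow_le_rpow (mul_le_mul_left hst _) hp.le
  exact ENNReal.continuous_rpow_const.comp_lowerSemicontinuous sum_lsc
    (ENNReal.monotone_rpow_of_nonneg (div_pos (min_one_pos hp) hp).le)

theorem classNorm_le_of_tendsto (hp : 0 < p) {ι : Type*} {f : Filter ι} [f.NeBot]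
    {u : ι → L2 d H →L[ℂ] L2 d H} {T : L2 d H →L[ℂ] L2 d H} (hu : Tendsto u f (𝓝 T)) {c : ℝ≥0∞}
    (h : ∀ᶠ i in f, classNorm p ν (u i) ≤ c) : classNorm p ν T ≤ c :=
  ((lowerSemicontinuous_classNorm hp).isClosed_preimage c).mem_of_tendsto hu h

end ClassNorm

/-! ### Wiener's lemma for the weighted class -/

section Wiener

variable {d : ℕ} {H : Type*} [NormedAddCommGroup H] [InnerProductSpace ℂ H] {p : ℝ}
  {ν : (Fin d → ℤ) → ℝ≥0}

/-- The restriction of a matrix to the side diagonals with index in `s`. -/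
def truncation (s : Set (Fin d → ℤ)) (A : OpMatrix d H) : OpMatrix d H :=
  fun k l => s.indicator (fun _ => A k l) (k - l)

theorem diagSup_truncation (s : Set (Fin d → ℤ)) (A : OpMatrix d H) :
    diagSup (truncation s A) = (diagSup A).restrict s := by
  ext l
  by_cases hl : l ∈ s
  · simp [diagSup_apply, truncation, ConvSeq.restrict_apply, hl]
  · simp only [diagSup_apply, truncation, ConvSeq.restrict_apply, sub_sub_cancel,
      Set.indicator_of_notMem hl, iSup_const]
    exact enorm_zero (E := H →L[ℂ] H)

theorem sub_truncation (s : Set (Fin d → ℤ)) (A : OpMatrix d H) :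
    A - truncation s A = truncation sᶜ A := by
  funext k l
  by_cases h : k - l ∈ s <;> simp [truncation, h]

theorem tendsto_mass_restrict_compl {G : Type*} {a : ConvSeq G} (ha : a.mass ≠ ∞) :
    Tendsto (fun s : Finset G => (a.restrict (s : Set G)ᶜ).mass) atTop (𝓝 0) :=
  tendsto_tsum_indicator_compl ha

variable [CompleteSpace H]

theorem exists_classNorm_lt_top_mass_decay_sub_lt (hp : 0 < p) {S : L2 d H →L[ℂ] L2 d H}
    (hS : (decay S).mass ≠ ∞) {ε : ℝ≥0∞} (hε : 0 < ε) :
    ∃ B : L2 d H →L[ℂ] L2 d H, classNorm p ν B < ∞ ∧ (decay (S - B)).mass < ε := by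
  obtain ⟨s, hs⟩ := ((tendsto_mass_restrict_compl hS).eventually (gt_mem_nhds hε)).exists
  set A := truncation (s : Set (Fin d → ℤ)) (canonicalMatrix S)
  have diagSup_A : diagSup A = (decay S).restrict s := diagSup_truncation _ _
  have mass_A : (diagSup A).mass ≠ ∞ :=
    ne_top_of_le_ne_top hS (diagSup_A ▸ ConvSeq.mass_mono (ConvSeq.restrict_le _ _))
  refine ⟨matrixOp A mass_A, ?_, ?_⟩
  · rw [classNorm, decay, canonicalMatrix_matrixOp, diagSup_A]
    exact weightedNorm_restrict_lt_top hp (diagSup_ne_top hS) s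
  · rwa [decay, canonicalMatrix_sub, canonicalMatrix_matrixOp, sub_truncation, diagSup_truncation]

theorem norm_lt_one_of_mass_decay_lt_one {R : L2 d H →L[ℂ] L2 d H} (hR : (decay R).mass < 1) :
    ‖R‖ < 1 := by
  rw [← ENNReal.ofReal_lt_one, ofReal_norm]
  exact (enorm_le_mass_decay R).trans_lt hR

theorem classNorm_tsum_pow_lt_top (hp : 0 < p) (hν : IsAdmissible ν)
    (hpν : 1 < p → IsPAlgebraWeight p ν) {R : L2 d H →L[ℂ] L2 d H} (hR : classNorm p ν R < ∞)
    (hR1 : (decay R).mass < 1) : classNorm p ν (∑' n : ℕ, R ^ n) < ∞ := by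
  have hasSum_pow : HasSum (fun n : ℕ => R ^ n) (∑' n : ℕ, R ^ n) :=
    (summable_geometric_of_norm_lt_one (norm_lt_one_of_mass_decay_lt_one hR1)).hasSum
  calc classNorm p ν (∑' n : ℕ, R ^ n)
      ≤ ∑' n : ℕ, classNorm p ν (R ^ n) :=
        classNorm_le_of_tendsto hp hasSum_pow <| Eventually.of_forall fun s =>
          (classNorm_sum_le hp s _).trans (ENNReal.sum_le_tsum s)
    _ ≤ ∑' n : ℕ, weightedNorm p ν (decay R ^ n) :=
        ENNReal.tsum_le_tsum fun n => weightedNorm_mono hp (decay_pow_le R n)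
    _ < ∞ := tsum_weightedNorm_pow_lt_top hp hν hpν hR hR1

/-- The operators whose canonical matrix belongs to the class, as a `*`-algebra. -/
def bgsStarSubalgebra (H : Type*) [NormedAddCommGroup H] [InnerProductSpace ℂ H]
    [CompleteSpace H] (hp : 0 < p) (hν : IsAdmissible ν)
    (hpν : 1 < p → IsPAlgebraWeight p ν) : StarSubalgebra ℂ (L2 d H →L[ℂ] L2 d H) where
  carrier := {T | classNorm p ν T < ∞}
  mul_mem' {S T} hS hT := (classNorm_mul_le hp hν hpν S T).trans_lt (ENNReal.mul_lt_top hS hT)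
  add_mem' {S T} hS hT := (classNorm_add_le hp S T).trans_lt (ENNReal.add_lt_top.2 ⟨hS, hT⟩)
  algebraMap_mem' c := by
    rw [Algebra.algebraMap_eq_smul_one, Set.mem_ofPred_eq, classNorm_smul hp]
    exact ENNReal.mul_lt_top (ENNReal.rpow_lt_top_of_nonneg (min_one_pos hp).le enorm_ne_top)
      (classNorm_one_lt_top hp)
  star_mem' {T} hT := (classNorm_star hν T).trans_lt hT

theorem mem_bgsStarSubalgebra {hp : 0 < p} {hν : IsAdmissible ν}
    {hpν : 1 < p → IsPAlgebraWeight p ν} {T : L2 d H →L[ℂ] L2 d H} :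
    T ∈ bgsStarSubalgebra H hp hν hpν ↔ classNorm p ν T < ∞ := Iff.rfl

theorem inverse_mem_bgsStarSubalgebra (hp : 0 < p) (hν : IsAdmissible ν)
    (hpν : 1 < p → IsPAlgebraWeight p ν)
    (hpν' : 1 < p → ∑' n, (ν n : ℝ≥0∞) ^ (-p.conjExponent) < ∞)
    {S T : L2 d H →L[ℂ] L2 d H} (hST : S * T = 1) (hTS : T * S = 1)
    (hT : T ∈ bgsStarSubalgebra H hp hν hpν) : S ∈ bgsStarSubalgebra H hp hν hpν := by
  have mass_T : (decay T).mass ≠ ∞ :=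
    (mass_lt_top_of_weightedNorm_lt_top hp hν.one_le hpν' hT).ne
  have mass_S : (decay S).mass ≠ ∞ := (mass_decay_inverse_lt_top hST hTS mass_T).ne
  obtain ⟨B, hB, mass_sub_lt⟩ := exists_classNorm_lt_top_mass_decay_sub_lt (ν := ν) hp mass_S
    (ENNReal.inv_pos.2 mass_T)
  set R := 1 - T * B with hR
  have R_mem : R ∈ bgsStarSubalgebra H hp hν hpν := sub_mem (one_mem _) (mul_mem hT hB)
  have mass_R : (decay R).mass < 1 :=
    calc (decay R).mass = (decay (T * (S - B))).mass := by rw [mul_sub, hTS]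
      _ ≤ (decay T).mass * (decay (S - B)).mass :=
        (ConvSeq.mass_mono (decay_mul_le _ _)).trans_eq (ConvSeq.mass_mul _ _)
      _ < 1 := ENNReal.mul_lt_of_lt_div' (by rwa [one_div])
  have right_inverse : T * (B * ∑' n : ℕ, R ^ n) = 1 := by
    have := mul_neg_geom_series R (norm_lt_one_of_mass_decay_lt_one mass_R)
    rwa [hR, sub_sub_cancel, mul_assoc] at this
  rw [left_inv_eq_right_inv hST right_inverse]
  exact mul_mem (s := bgsStarSubalgebra H hp hν hpν) hB
    (classNorm_tsum_pow_lt_top hp hν hpν R_mem mass_R)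

theorem isInverseClosed_bgsStarSubalgebra (hp : 0 < p) (hν : IsAdmissible ν)
    (hpν : 1 < p → IsPAlgebraWeight p ν)
    (hpν' : 1 < p → ∑' n, (ν n : ℝ≥0∞) ^ (-p.conjExponent) < ∞) :
    IsInverseClosed (bgsStarSubalgebra H hp hν hpν).toSubalgebra := by
  rintro ⟨T, hT⟩ ⟨⟨_, S, hTS, hST⟩, rfl⟩
  have hS := inverse_mem_bgsStarSubalgebra hp hν hpν hpν' hST hTS hT
  exact ⟨⟨⟨_, hT⟩, ⟨S, hS⟩, Subtype.ext hTS, Subtype.ext hST⟩, rfl⟩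

end Wiener

/-! ### Completeness and symmetry -/

section Completeness

variable {d : ℕ} {H : Type*} [NormedAddCommGroup H] [InnerProductSpace ℂ H] [CompleteSpace H]
  {p : ℝ} {ν : (Fin d → ℤ) → ℝ≥0}

theorem exists_enorm_le_mul_classNorm_rpow (H : Type*) [NormedAddCommGroup H]
    [InnerProductSpace ℂ H] [CompleteSpace H] (hp : 0 < p) (hν : ∀ l, 1 ≤ ν l)
    (hpν : 1 < p → ∑' n, (ν n : ℝ≥0∞) ^ (-p.conjExponent) < ∞) :
    ∃ K : ℝ≥0∞, K ≠ ∞ ∧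
      ∀ T : L2 d H →L[ℂ] L2 d H, ‖T‖ₑ ≤ K * classNorm p ν T ^ (1 / min p 1) := by
  obtain ⟨K, K_ne_top, hK⟩ := exists_mass_le_mul_weightedNorm_rpow hp hν hpν
  exact ⟨K, K_ne_top, fun T => (enorm_le_mass_decay T).trans (hK _)⟩

theorem cauchySeq_of_tendsto_classNorm_sub (hp : 0 < p) (hν : ∀ l, 1 ≤ ν l)
    (hpν : 1 < p → ∑' n, (ν n : ℝ≥0∞) ^ (-p.conjExponent) < ∞)
    {u : ℕ → L2 d H →L[ℂ] L2 d H}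
    (hu : Tendsto (fun n : ℕ × ℕ => classNorm p ν (u n.1 - u n.2)) atTop (𝓝 0)) :
    CauchySeq u := by
  obtain ⟨K, K_ne_top, hK⟩ := exists_enorm_le_mul_classNorm_rpow H hp hν hpν
  have tendsto_bound : Tendsto
      (fun n : ℕ × ℕ => K * classNorm p ν (u n.1 - u n.2) ^ (1 / min p 1)) atTop (𝓝 0) := by
    have bound_continuous : Continuous fun t : ℝ≥0∞ => K * t ^ (1 / min p 1) :=
      (ENNReal.continuous_const_mul K_ne_top).comp ENNReal.continuous_rpow_const
    have := (bound_continuous.tendsto 0).comp hu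
    rwa [ENNReal.zero_rpow_of_pos (one_div_pos.2 (min_one_pos hp)), mul_zero] at this
  have tendsto_enorm : Tendsto (fun n : ℕ × ℕ => ‖u n.1 - u n.2‖ₑ) atTop (𝓝 0) :=
    tendsto_of_tendsto_of_tendsto_of_le_of_le tendsto_const_nhds tendsto_bound
      (fun _ => zero_le) fun _ => hK _
  rw [cauchySeq_iff_tendsto, tendsto_uniformity_iff_dist_tendsto_zero]
  simpa only [Function.comp_def, Prod.map, dist_eq_norm, toReal_enorm, ENNReal.toReal_zero] using
    (ENNReal.tendsto_toReal ENNReal.zero_ne_top).comp tendsto_enorm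

theorem exists_tendsto_classNorm_sub (hp : 0 < p) (hν : ∀ l, 1 ≤ ν l)
    (hpν : 1 < p → ∑' n, (ν n : ℝ≥0∞) ^ (-p.conjExponent) < ∞)
    {u : ℕ → L2 d H →L[ℂ] L2 d H}
    (hu : Tendsto (fun n : ℕ × ℕ => classNorm p ν (u n.1 - u n.2)) atTop (𝓝 0)) :
    ∃ T, Tendsto (fun n => classNorm p ν (u n - T)) atTop (𝓝 0) := by
  obtain ⟨T, hT⟩ :=
    cauchySeq_tendsto_of_complete (cauchySeq_of_tendsto_classNorm_sub hp hν hpν hu)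
  refine ⟨T, ENNReal.tendsto_nhds_zero.2 fun ε hε => ?_⟩
  have eventually_le := ENNReal.tendsto_nhds_zero.1 hu ε hε
  rw [← prod_atTop_atTop_eq] at eventually_le
  exact eventually_le.curry.mono fun n hn => classNorm_le_of_tendsto hp (hT.const_sub (u n)) hn

theorem exists_mem_bgsStarSubalgebra_tendsto (hp : 0 < p) (hν : IsAdmissible ν)
    (hpν : 1 < p → IsPAlgebraWeight p ν)
    (hpν' : 1 < p → ∑' n, (ν n : ℝ≥0∞) ^ (-p.conjExponent) < ∞)
    {u : ℕ → L2 d H →L[ℂ] L2 d H} (u_mem : ∀ n, u n ∈ bgsStarSubalgebra H hp hν hpν)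
    (hu : ∀ ε > 0, ∃ n₀, ∀ m ≥ n₀, ∀ n ≥ n₀, (classNorm p ν (u m - u n)).toReal < ε) :
    ∃ T ∈ bgsStarSubalgebra H hp hν hpν,
      Tendsto (fun n => (classNorm p ν (u n - T)).toReal) atTop (𝓝 0) := by
  have sub_ne_top (n : ℕ × ℕ) : classNorm p ν (u n.1 - u n.2) ≠ ∞ :=
    (mem_bgsStarSubalgebra.1 (sub_mem (u_mem n.1) (u_mem n.2))).ne
  have tendsto_sub : Tendsto (fun n : ℕ × ℕ => classNorm p ν (u n.1 - u n.2)) atTop (𝓝 0) := by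
    rw [← ENNReal.tendsto_toReal_zero_iff sub_ne_top, Metric.tendsto_atTop]
    intro ε hε
    obtain ⟨n₀, hn₀⟩ := hu ε hε
    refine ⟨(n₀, n₀), fun n hn => ?_⟩
    rw [Real.dist_0_eq_abs, abs_of_nonneg ENNReal.toReal_nonneg]
    exact hn₀ _ hn.1 _ hn.2
  obtain ⟨T, hT⟩ := exists_tendsto_classNorm_sub hp hν.one_le hpν' tendsto_sub
  obtain ⟨n, hn⟩ := (hT.eventually (gt_mem_nhds ENNReal.zero_lt_top)).exists
  refine ⟨T, ?_, (ENNReal.tendsto_toReal ENNReal.zero_ne_top).comp hT⟩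
  simpa only [sub_sub_cancel] using sub_mem (u_mem n) (mem_bgsStarSubalgebra.2 hn)

theorem isPBanachStarAlgebra_bgsStarSubalgebra (hp : 0 < p) (hν : IsAdmissible ν)
    (hpν : 1 < p → IsPAlgebraWeight p ν)
    (hpν' : 1 < p → ∑' n, (ν n : ℝ≥0∞) ^ (-p.conjExponent) < ∞) :
    IsPBanachStarAlgebra (min p 1) (fun T : bgsStarSubalgebra H hp hν hpν =>
      (classNorm p ν (T : L2 d H →L[ℂ] L2 d H)).toReal) where
  nonneg _ := ENNReal.toReal_nonneg
  eq_zero_iff S := by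
    rw [ENNReal.toReal_eq_zero_iff, or_iff_left (mem_bgsStarSubalgebra.1 S.2).ne,
      classNorm_eq_zero_iff hp hν, ZeroMemClass.coe_eq_zero]
  add_le S T :=
    (ENNReal.toReal_mono (ENNReal.add_ne_top.2 ⟨S.2.ne, T.2.ne⟩) (classNorm_add_le hp _ _)).trans
      ENNReal.toReal_add_le
  smul_eq c T := by
    rw [← toReal_enorm, ENNReal.toReal_rpow, ← ENNReal.toReal_mul, ← classNorm_smul hp]
    rfl
  mul_le S T := by
    rw [← ENNReal.toReal_mul]
    exact ENNReal.toReal_mono (ENNReal.mul_ne_top S.2.ne T.2.ne) (classNorm_mul_le hp hν hpν _ _)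
  star_eq T := congrArg ENNReal.toReal (classNorm_star hν (T : L2 d H →L[ℂ] L2 d H))
  complete u hu :=
    let ⟨T, T_mem, hT⟩ := exists_mem_bgsStarSubalgebra_tendsto hp hν hpν hpν'
      (fun n => (u n).2) hu
    ⟨⟨T, T_mem⟩, hT⟩

end Completeness

theorem IsInverseClosed.isSymmetricAlgebra {ℬ : Type*} [CStarAlgebra ℬ] {S : StarSubalgebra ℂ ℬ}
    (hS : IsInverseClosed S.toSubalgebra) : IsSymmetricAlgebra S := by
  intro a z hz
  have mem_spectrum : z ∈ spectrum ℂ ((a : ℬ) * star (a : ℬ)) := fun h =>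
    hz (hS (algebraMap ℂ S z - a * star a) h)
  have z_eq_re : z = z.re := (IsSelfAdjoint.mul_star_self (a : ℬ)).mem_spectrum_eq_re mem_spectrum
  rw [z_eq_re] at mem_spectrum
  refine ⟨z.re, ?_, z_eq_re.symm⟩
  have re_mem_spectrum : z.re ∈ spectrum ℝ ((a : ℬ) * star (a : ℬ)) :=
    (spectrum.algebraMap_mem_iff ℂ).1 mem_spectrum
  have nonneg := spectrum_star_mul_self_nonneg (b := star (a : ℬ)) z.re
  rw [star_star] at nonneg
  exact nonneg re_mem_spectrum

end BGS

end

theorem theorem4p4 {d : ℕ} {H : Type*} [NormedAddCommGroup H] [InnerProductSpace ℂ H]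
    [CompleteSpace H] (p : ℝ) (hp : 0 < p) (ν : (Fin d → ℤ) → ℝ≥0) (hν : BGS.IsAdmissible ν)
    (hpν : 1 < p → BGS.IsPAlgebraWeight p ν ∧
      ∑' n, (ν n : ℝ≥0∞) ^ (-p.conjExponent) < ∞) :
    -- every matrix in `C^p_ν` acts as a bounded operator on `ℓ²(ℤ^d, H)`
    (∀ A ∈ BGS.bgsClass d H p ν, ∃ T : BGS.L2 d H →L[ℂ] BGS.L2 d H,
      ∀ (x : BGS.L2 d H) (k : Fin d → ℤ), HasSum (fun l => A k l (x l)) (T x k)) ∧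
    -- these operators form a unital `*`-subalgebra `S` of `B(ℓ²(ℤ^d, H))`
    ∃ S : StarSubalgebra ℂ (BGS.L2 d H →L[ℂ] BGS.L2 d H),
      (∀ T, T ∈ S ↔ BGS.canonicalMatrix T ∈ BGS.bgsClass d H p ν) ∧
      BGS.IsInverseClosed S.toSubalgebra ∧
      BGS.IsPBanachStarAlgebra (min p 1)
        (fun T : S => BGS.bgsNorm p ν (BGS.canonicalMatrix (T : BGS.L2 d H →L[ℂ] BGS.L2 d H))) ∧
      BGS.IsSymmetricAlgebra S := by
  have pAlgebra : 1 < p → BGS.IsPAlgebraWeight p ν := fun h => (hpν h).1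
  have summable_inv : 1 < p → ∑' n, (ν n : ℝ≥0∞) ^ (-p.conjExponent) < ∞ := fun h => (hpν h).2
  have inverseClosed := BGS.isInverseClosed_bgsStarSubalgebra (H := H) hp hν pAlgebra summable_inv
  refine ⟨fun A hA => ?_, BGS.bgsStarSubalgebra H hp hν pAlgebra,
    fun T => (BGS.mem_bgsClass_iff hp _).symm, inverseClosed, ?_,
    inverseClosed.isSymmetricAlgebra⟩
  · have mass_lt_top := BGS.mass_lt_top_of_weightedNorm_lt_top hp hν.one_le summable_inv
      ((BGS.mem_bgsClass_iff hp A).1 hA)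
    exact ⟨BGS.matrixOp A mass_lt_top.ne, BGS.hasSum_matrixOp_apply A mass_lt_top.ne⟩
  · simp only [BGS.bgsNorm_eq_toReal_weightedNorm hp]
    exact BGS.isPBanachStarAlgebra_bgsStarSubalgebra hp hν pAlgebra summable_inv
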